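/- Let $n\equiv 2$ or $3 \pmod 4$, let $Cl_n=Cl_{n,0}$ be the real Clifford algebra of Euclidean $\mathbb R^n$ with reversion $M\mapsto\widetilde M$, modulus $|M|^2=\langle M\widetilde M\rangle_0$ and unit pseudoscalar $i_n=e_1e_2\cdots e_n$ (so $i_n^2=-1$). For $f,g\in L^2(\mathbb R^n;Cl_n)$ put $(f,g)=\int_{\mathbb R^n} f(x)\widetilde{g(x)}\,d^nx\in Cl_n$, and let $\widehat f$ be the Clifford Fourier transform, i.e. the $L^2$-extension of $\widehat f(\omega)=\int_{\mathbb R^n} f(x)e^{-i_n\omega\cdot x}\,d^nx$. Let $\mathcal G=\{(a,r_\theta,b): a>0,\ r_\theta\in SO(n),\ b\in\mathbb R^n\}$ be the similitude group with the measures $d\mu=a^{-(n+1)}\,da\,d\theta$ and $d\lambda=d\mu\,d^nb$, where $d\theta$ is a (fixed, arbitrarily normalized) Haar measure on $SO(n)$. For $\psi:\mathbb R^n\to Cl_n$ put $\psi_{a,\theta,b}(x)=a^{-n/2}\psi\big(r_\theta^{-1}((x-b)/a)\big)$. Let $\psi\in L^2(\mathbb R^n;Cl_n)$ be admissible, i.e.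 there is an invertible multivector $C_\psi\in Cl_n$ such that for almost every $\omega\in\mathbb R^n$ the integral $$\int_{\mathbb R^+}\int_{SO(n)} a^n\,\{\widehat\psi(a r_\theta^{-1}\omega)\}^{\sim}\,\widehat\psi(a r_\theta^{-1}\omega)\,d\mu$$ converges absolutely and equals $C_\psi$. If $n\equiv 2\pmod 4$, assume moreover that $\psi$ takes values in the even part $Cl_n^+$ (put $\varepsilon=1$) or in the odd part $Cl_n^-$ (put $\varepsilon=-1$); if $n\equiv 3\pmod 4$ put $\varepsilon=1$. Let $C'_\psi=\varepsilon^n C_\psi$ (which equals $C_\psi$). For $f\in L^2(\mathbb R^n;Cl_n)$ let $T_\psi f(a,\theta,b)=(f,\psi_{a,\theta,b})$, and define $$K_\psi(a,\theta,b;a',\theta',b')=\big(\psi_{a,\theta,b}\,{C'_\psi}^{-1},\ \psi_{a',\theta',b'}\big).$$ Then $K_\psi$ is a reproducing kernel in $L^2(\mathcal G,d\lambda)$: for every $f\in L^2(\mathbb R^n;Cl_n)$ one has $T_\psi f\in L^2(\mathcal G;Cl_n)$, and for every $(a',\theta',b')\in\mathcal G$ the function $K_\psi(\cdot\,;a',\theta',b')$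 belongs to $L^2(\mathcal G;Cl_n)$, the function $T_\psi f(\cdot)\,K_\psi(\cdot\,;a',\theta',b')$ is integrable over $\mathcal G$, and $$T_\psi f(a',\theta',b')=\int_{\mathcal G}T_\psi f(a,\theta,b)\,K_\psi(a,\theta,b;a',\theta',b')\,d\lambda(a,\theta,b).$$ -/

import Mathlib

open MeasureTheory Filter Topology

noncomputable section

namespace CliffordWavelet

/-- Euclidean space `ℝⁿ`. -/
abbrev E (n : ℕ) : Type := EuclideanSpace ℝ (Fin n)

/-- The quadratic form `Q(x) = x · x` on `ℝⁿ`. -/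
abbrev Q (n : ℕ) : QuadraticForm ℝ (E n) := LinearMap.BilinMap.toQuadraticMap (innerₗ (E n))

/-- The Clifford algebra `Cl_n = Cl_{n,0}`. -/
abbrev Cl (n : ℕ) : Type := CliffordAlgebra (Q n)

/-- The vector `e_i` of the standard orthonormal basis, as an element of `Cl_n`. -/
def vec (n : ℕ) (i : Fin n) : Cl n := CliffordAlgebra.ι (Q n) (EuclideanSpace.single i (1 : ℝ))

/-- The unit pseudoscalar `i_n = e_1 e_2 ⋯ e_n`. -/
def pseudoscalar (n : ℕ) : Cl n := (List.ofFn (vec n)).prod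

/-- The scalar part `⟨M⟩₀`: the degree-zero component of `M` under the canonical linear
identification of the Clifford algebra with the exterior algebra. -/
def scalarPart (n : ℕ) : Cl n →ₗ[ℝ] ℝ :=
  (ExteriorAlgebra.algebraMapInv (R := ℝ) (M := E n)).toLinearMap ∘ₗ
    (CliffordAlgebra.equivExterior (Q n)).toLinearMap

/-! The scalar product `⟨M Ñ⟩₀` is an inner product, for which the blades `e_A` form an orthonormal
basis; the associated norm is the modulus `|M|`. -/

/-- The product `e_{i_1} ⋯ e_{i_k}` along a list of indices. -/
def word (n : ℕ) (l : List (Fin n)) : Cl n := (l.map (vec n)).prod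

/-- The blade `e_A`, factors in increasing order. -/
def blade (n : ℕ) (A : Finset (Fin n)) : Cl n := word n (A.sort (· ≤ ·))

theorem vec_mul_self (n : ℕ) (i : Fin n) : vec n i * vec n i = 1 := by
  simp [vec, CliffordAlgebra.ι_sq_scalar]

theorem vec_mul_vec (n : ℕ) {i j : Fin n} (h : i ≠ j) :
    vec n i * vec n j = -(vec n j * vec n i) := by
  rw [eq_neg_iff_add_eq_zero]
  unfold vec
  rw [CliffordAlgebra.ι_mul_ι_add_swap]
  simp [QuadraticMap.polar, inner_add_right, EuclideanSpace.inner_single_left,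
    h, h.symm]

theorem vec_mul_word (n : ℕ) (i : Fin n) (l : List (Fin n)) (hl : l.Pairwise (· < ·)) :
    ∃ l' : List (Fin n), l'.Pairwise (· < ·) ∧ (∀ j, j ∈ l' ↔ Xor (j = i) (j ∈ l)) ∧
      (vec n i * word n l = word n l' ∨ vec n i * word n l = -word n l') := by
  induction l with
  | nil => exact ⟨[i], by simp, by simp [Xor], Or.inl (by simp [word])⟩
  | cons a t ih =>
    rw [List.pairwise_cons] at hl
    obtain ⟨hat, ht⟩ := hl
    rcases lt_trichotomy i a with h | h | h
    · refine ⟨i :: a :: t, ?_, ?_, Or.inl (by simp [word])⟩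
      · simp only [List.pairwise_cons, List.mem_cons]
        exact ⟨fun b hb => hb.elim (fun e => e ▸ h) (fun hb => h.trans (hat b hb)), hat, ht⟩
      · intro j
        have h1 : i ≠ a := h.ne
        have h2 : i ∉ t := fun hi => absurd (hat i hi) (not_lt.mpr h.le)
        simp only [List.mem_cons, Xor]
        grind
    · subst h
      refine ⟨t, ht, ?_, Or.inl (by simp [word, ← mul_assoc, vec_mul_self])⟩
      intro j
      have h2 : i ∉ t := fun hi => lt_irrefl _ (hat i hi)
      simp only [List.mem_cons, Xor]
      grind
    · obtain ⟨t', ht', hm, hs⟩ := ih ht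
      refine ⟨a :: t', ?_, ?_, ?_⟩
      · rw [List.pairwise_cons]
        refine ⟨fun b hb => ?_, ht'⟩
        rcases (hm b).1 hb with ⟨e, -⟩ | ⟨hb, -⟩
        · exact e ▸ h
        · exact hat b hb
      · intro j
        have h1 : i ≠ a := h.ne'
        have h2 : a ∉ t := fun hi => lt_irrefl _ (hat a hi)
        have := hm j
        simp only [List.mem_cons, Xor] at this ⊢
        grind
      · have e1 : vec n i * word n (a :: t) = -(vec n a * (vec n i * word n t)) := by
          simp only [word, List.map_cons, List.prod_cons]
          rw [← mul_assoc, vec_mul_vec n h.ne', neg_mul, mul_assoc]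
        have e2 : word n (a :: t') = vec n a * word n t' := by simp [word]
        rw [e1, e2]
        rcases hs with hs | hs <;> rw [hs] <;> simp

theorem equivExterior_word (n : ℕ) (l : List (Fin n)) (hl : l.Nodup) :
    CliffordAlgebra.equivExterior (Q n) (word n l) =
      (l.map fun i => ExteriorAlgebra.ι ℝ (EuclideanSpace.single i (1 : ℝ) : E n)).prod := by
  have key : ∀ (i : Fin n) (l : List (Fin n)), i ∉ l →
      CliffordAlgebra.contractLeft (Q := (0 : QuadraticForm ℝ (E n)))
        ((QuadraticMap.associated (R := ℝ) (-(Q n))) (EuclideanSpace.single i (1 : ℝ)))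
      (l.map fun i => CliffordAlgebra.ι (0 : QuadraticForm ℝ (E n))
        (EuclideanSpace.single i (1 : ℝ) : E n)).prod = 0 := by
    intro i l
    induction l with
    | nil => simp
    | cons a t ih =>
      intro h
      simp only [List.mem_cons, not_or] at h
      simp only [List.map_cons, List.prod_cons]
      rw [CliffordAlgebra.contractLeft_ι_mul, ih h.2]
      simp [QuadraticMap.associated_apply, inner_add_right,
        EuclideanSpace.inner_single_left, h.1, Ne.symm h.1]
  induction l with
  | nil => simp [word, CliffordAlgebra.equivExterior]
  | cons a t ih =>
    rw [List.nodup_cons] at hl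
    have e : word n (a :: t) = vec n a * word n t := by simp [word]
    have ih' := ih hl.2
    rw [e, List.map_cons, List.prod_cons]
    unfold CliffordAlgebra.equivExterior at ih' ⊢
    rw [CliffordAlgebra.changeFormEquiv_apply] at ih' ⊢
    unfold vec
    rw [CliffordAlgebra.changeForm_ι_mul, ih']
    have := key a t hl.1
    erw [this]
    rw [sub_zero]

theorem scalarPart_word (n : ℕ) (l : List (Fin n)) (hl : l.Nodup) :
    scalarPart n (word n l) = if l = [] then 1 else 0 := by
  simp only [scalarPart, LinearMap.comp_apply, LinearEquiv.coe_coe, equivExterior_word n l hl]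
  cases l with
  | nil => simp
  | cons a t => simp [ExteriorAlgebra.algebraMapInv]

theorem word_mul_word (n : ℕ) (k l : List (Fin n)) (hk : k.Nodup) (hl : l.Pairwise (· < ·)) :
    ∃ l' : List (Fin n), l'.Pairwise (· < ·) ∧ (∀ j, j ∈ l' ↔ Xor (j ∈ k) (j ∈ l)) ∧
      (word n k * word n l = word n l' ∨ word n k * word n l = -word n l') := by
  induction k with
  | nil => exact ⟨l, hl, by simp [Xor], Or.inl (by simp [word])⟩
  | cons a t ih =>
    rw [List.nodup_cons] at hk
    obtain ⟨m, hm, hmem, hs⟩ := ih hk.2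
    obtain ⟨m', hm', hmem', hs'⟩ := vec_mul_word n a m hm
    refine ⟨m', hm', fun j => ?_, ?_⟩
    · have h1 := hmem j
      have h2 := hmem' j
      have h3 := hk.1
      simp only [List.mem_cons, Xor] at *
      grind
    · have e : word n (a :: t) = vec n a * word n t := by simp [word]
      rw [e, mul_assoc]
      rcases hs with hs | hs <;> rcases hs' with hs' | hs' <;> simp [hs, hs']

theorem reverse_word (n : ℕ) (l : List (Fin n)) :
    CliffordAlgebra.reverse (word n l) = word n l.reverse := by
  induction l with
  | nil => simp [word]
  | cons a t ih =>
    have e : word n (a :: t) = vec n a * word n t := by simp [word]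
    rw [e, CliffordAlgebra.reverse.map_mul, ih]
    simp [word, vec]

theorem word_mul_reverse (n : ℕ) (l : List (Fin n)) : word n l * word n l.reverse = 1 := by
  induction l with
  | nil => simp [word]
  | cons a t ih =>
    have e : word n (a :: t) = vec n a * word n t := by simp [word]
    have e' : word n (a :: t).reverse = word n t.reverse * vec n a := by simp [word]
    rw [e, e', mul_assoc, ← mul_assoc (word n t), ih, one_mul, vec_mul_self]

/-- The blades `e_A` are orthonormal for `⟨M Ñ⟩₀`. -/
theorem scalarPart_blade_mul_reverse (n : ℕ) (A B : Finset (Fin n)) :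
    scalarPart n (blade n A * CliffordAlgebra.reverse (blade n B)) = if A = B then 1 else 0 := by
  have h1 : scalarPart n 1 = 1 := by simpa [word] using scalarPart_word n [] List.nodup_nil
  unfold blade
  rw [reverse_word]
  split_ifs with h
  · subst h
    rw [word_mul_reverse, h1]
  · set a := A.sort (· ≤ ·) with ha
    set b := B.sort (· ≤ ·) with hb
    have hbs : b.Pairwise (· < ·) := (B.sortedLT_sort).pairwise
    have hbn : b.Nodup := B.sort_nodup _
    have hbr : word n b.reverse = word n b ∨ word n b.reverse = -word n b := by
      obtain ⟨m, -, hm, hs⟩ := word_mul_word n b b hbn hbs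
      have : m = [] := by
        rw [List.eq_nil_iff_forall_not_mem]
        intro j hj
        simpa [Xor] using (hm j).1 hj
      subst this
      have hone : word n b.reverse * word n b = 1 := by
        simpa using word_mul_reverse n b.reverse
      have h2 : word n b.reverse * (word n b * word n b) = word n b := by
        rw [← mul_assoc, hone, one_mul]
      rcases hs with hs | hs <;> rw [hs] at h2
      · left; simpa [word] using h2
      · right; rw [← h2]; simp [word]
    obtain ⟨m, hm, hmem, hs⟩ := word_mul_word n a b (A.sort_nodup _) hbs
    have hne : m ≠ [] := by
      rintro rfl
      apply h
      ext j
      have := hmem j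
      simp only [List.not_mem_nil, Xor, ha, hb, Finset.mem_sort] at this
      grind
    have h0 : scalarPart n (word n m) = 0 := by
      rw [scalarPart_word n m (hm.imp (fun h => h.ne)), if_neg hne]
    rcases hbr with hbr | hbr <;> rcases hs with hs | hs <;> simp [hbr, hs, h0]

/-- The blades `e_A` span `Cl_n`. -/
theorem span_blade (n : ℕ) : Submodule.span ℝ (Set.range (blade n)) = ⊤ := by
  have hmul : ∀ (v : E n) (x : Cl n), x ∈ Submodule.span ℝ (Set.range (blade n)) →
      CliffordAlgebra.ι (Q n) v * x ∈ Submodule.span ℝ (Set.range (blade n)) := by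
    intro v x hx
    have hv : CliffordAlgebra.ι (Q n) v = ∑ i, v i • vec n i := by
      conv_lhs => rw [← (EuclideanSpace.basisFun (Fin n) ℝ).sum_repr v]
      simp [vec]
    rw [hv, Finset.sum_mul]
    refine Submodule.sum_mem _ fun i _ => ?_
    rw [smul_mul_assoc]
    refine Submodule.smul_mem _ _ ?_
    induction hx using Submodule.span_induction with
    | mem y hy =>
      obtain ⟨A, rfl⟩ := hy
      obtain ⟨m, hm, -, hs⟩ := vec_mul_word n i (A.sort (· ≤ ·)) (A.sortedLT_sort).pairwise
      have hmem : word n m ∈ Submodule.span ℝ (Set.range (blade n)) := by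
        refine Submodule.subset_span ⟨m.toFinset, ?_⟩
        have : m.toFinset.sort (· ≤ ·) = m :=
          (List.toFinset_sort (· ≤ ·) (hm.imp fun h => h.ne)).2 (hm.imp fun h => h.le)
        rw [blade, this]
      unfold blade
      rcases hs with hs | hs <;> rw [hs]
      · exact hmem
      · exact Submodule.neg_mem _ hmem
    | zero => simp
    | add y z _ _ h1 h2 => rw [mul_add]; exact Submodule.add_mem _ h1 h2
    | smul c y _ h => rw [mul_smul_comm]; exact Submodule.smul_mem _ _ h
  have h1 : (1 : Cl n) ∈ Submodule.span ℝ (Set.range (blade n)) :=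
    Submodule.subset_span ⟨∅, by simp [blade, word]⟩
  rw [eq_top_iff]
  intro x _
  induction x using CliffordAlgebra.left_induction with
  | algebraMap r =>
    rw [Algebra.algebraMap_eq_smul_one]; exact Submodule.smul_mem _ _ h1
  | add y z hy hz => exact Submodule.add_mem _ (hy trivial) (hz trivial)
  | ι_mul x v hx => exact hmul v x (hx trivial)

theorem exists_eq_sum_blade (n : ℕ) (M : Cl n) :
    ∃ c : Finset (Fin n) → ℝ, ∑ A, c A • blade n A = M := by
  have : M ∈ Submodule.span ℝ (Set.range (blade n)) := by rw [span_blade]; trivial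
  exact (Submodule.mem_span_range_iff_exists_fun ℝ).1 this

/-- `⟨M Ñ⟩₀ = ∑_A M_A N_A`. -/
theorem scalarPart_sum_blade (n : ℕ) (c d : Finset (Fin n) → ℝ) :
    scalarPart n ((∑ A, c A • blade n A) * CliffordAlgebra.reverse (∑ A, d A • blade n A)) =
      ∑ A, c A * d A := by
  simp [Finset.sum_mul, Finset.mul_sum, scalarPart_blade_mul_reverse, mul_comm]

/-- The inner product `M ∗ Ñ = ⟨M Ñ⟩₀` on `Cl_n`. -/
abbrev innerCore (n : ℕ) : InnerProductSpace.Core ℝ (Cl n) where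
  inner M N := scalarPart n (M * CliffordAlgebra.reverse N)
  conj_inner_symm M N := by
    obtain ⟨c, rfl⟩ := exists_eq_sum_blade n M
    obtain ⟨d, rfl⟩ := exists_eq_sum_blade n N
    simp only [scalarPart_sum_blade]
    simp [mul_comm]
  re_inner_nonneg M := by
    obtain ⟨c, rfl⟩ := exists_eq_sum_blade n M
    simp only [scalarPart_sum_blade, RCLike.re_to_real]
    exact Finset.sum_nonneg fun A _ => mul_self_nonneg (c A)
  add_left M N P := by simp [add_mul]
  smul_left M N r := by simp
  definite M h := by
    obtain ⟨c, rfl⟩ := exists_eq_sum_blade n M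
    rw [scalarPart_sum_blade,
      Finset.sum_eq_zero_iff_of_nonneg fun A _ => mul_self_nonneg (c A)] at h
    refine Finset.sum_eq_zero fun A hA => ?_
    rw [mul_self_eq_zero.1 (h A hA), zero_smul]

instance instNormedAddCommGroupCl (n : ℕ) : NormedAddCommGroup (Cl n) :=
  (innerCore n).toNormedAddCommGroup

instance instInnerProductSpaceCl (n : ℕ) : InnerProductSpace ℝ (Cl n) :=
  InnerProductSpace.ofCore (innerCore n).toCore

instance instFiniteDimensionalCl (n : ℕ) : FiniteDimensional ℝ (Cl n) :=
  ⟨(Submodule.fg_def).2 ⟨Set.range (blade n), Set.finite_range _, span_blade n⟩⟩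

/-- The `Cl_n`-valued inner product `(f, g) = ∫ f(x) g(x)~ dⁿx`. -/
def l2Inner {n : ℕ} (f g : E n → Cl n) : Cl n := ∫ x, f x * CliffordAlgebra.reverse (g x)

/-- `e^{i_n t} = cos t + i_n sin t` (used for `n ≡ 2, 3 mod 4`, where `i_n² = -1`). -/
def expI (n : ℕ) (t : ℝ) : Cl n := Real.cos t • (1 : Cl n) + Real.sin t • pseudoscalar n

/-- The Clifford Fourier integral `∫ f(x) e^{-i_n ω·x} dⁿx`, for integrable `f`. -/
def cftIntegral {n : ℕ} (f : E n → Cl n) (ω : E n) : Cl n :=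
  ∫ x, f x * expI n (-(inner ℝ ω x))

/-- `φ` is (a representative of) the Clifford Fourier transform of `f ∈ L²`: the limit in `L²` of
the Fourier integrals over the balls `|x| ≤ R`, as `R → ∞`. -/
def IsCFT {n : ℕ} (f φ : E n → Cl n) : Prop :=
  MemLp φ 2 volume ∧
    Tendsto (fun R : ℝ =>
      eLpNorm (φ - cftIntegral ((Metric.closedBall (0 : E n) R).indicator f)) 2 volume)
      atTop (𝓝 0)

open Classical in
/-- The Clifford Fourier transform of `f ∈ L²`, determined almost everywhere. -/
def cft {n : ℕ} (f : E n → Cl n) : E n → Cl n :=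
  if h : ∃ φ, IsCFT f φ then h.choose else 0

/-- The rotation group `SO(n)`. -/
abbrev SO (n : ℕ) : Type := Matrix.specialOrthogonalGroup (Fin n) ℝ

instance instMeasurableSpaceSO (n : ℕ) : MeasurableSpace (SO n) := borel (SO n)

instance instBorelSpaceSO (n : ℕ) : BorelSpace (SO n) := ⟨rfl⟩

/-- The action of a rotation on `ℝⁿ`. -/
def rotate {n : ℕ} (r : SO n) (x : E n) : E n := WithLp.toLp 2 (r.1.mulVec x.ofLp)

/-- Dilations and rotations: pairs `(a, r)` with `a > 0` and `r ∈ SO(n)`. -/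
abbrev DilRot (n : ℕ) : Type := Set.Ioi (0 : ℝ) × SO n

/-- The similitude group `SIM(n)`: triples `((a, r), b)`. -/
abbrev SIM (n : ℕ) : Type := DilRot n × E n

/-- The measure `da / a^{n+1}` on `ℝ⁺`. -/
def scaleMeasure (n : ℕ) : Measure (Set.Ioi (0 : ℝ)) :=
  ((volume : Measure ℝ).comap Subtype.val).withDensity
    fun a => ENNReal.ofReal ((a : ℝ) ^ (n + 1))⁻¹

/-- `dμ(a, θ) = da dθ / a^{n+1}`, where `dθ = ν` is the Haar measure on `SO(n)`. -/
def muMeasure {n : ℕ} (ν : Measure (SO n)) : Measure (DilRot n) := (scaleMeasure n).prod ν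

/-- The left Haar measure `dλ(a, θ, b) = dμ(a, θ) dⁿb` on `SIM(n)`. -/
def simMeasure {n : ℕ} (ν : Measure (SO n)) : Measure (SIM n) := (muMeasure ν).prod volume

/-- The daughter wavelet `ψ_{a,θ,b}(x) = a^{-n/2} ψ(r_θ⁻¹((x - b)/a))`. -/
def daughter {n : ℕ} (ψ : E n → Cl n) (g : SIM n) (x : E n) : Cl n :=
  ((g.1.1 : ℝ) ^ (-(n : ℝ) / 2)) •
    ψ (rotate g.1.2⁻¹ ((g.1.1 : ℝ)⁻¹ • (x - g.2)))

/-- The integrand `aⁿ ψ̂(a r_θ⁻¹ ω)~ ψ̂(a r_θ⁻¹ ω)` of the admissibility constant. -/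
def admissibilityIntegrand {n : ℕ} (ψ : E n → Cl n) (ω : E n) (p : DilRot n) : Cl n :=
  ((p.1 : ℝ) ^ n) •
    (CliffordAlgebra.reverse (cft ψ ((p.1 : ℝ) • rotate p.2⁻¹ ω)) *
      cft ψ ((p.1 : ℝ) • rotate p.2⁻¹ ω))

/-- `ψ` is an admissible mother wavelet with admissibility constant `C = C_ψ`: `ψ ∈ L²`, and
`∫_{ℝ⁺} ∫_{SO(n)} aⁿ ψ̂(a r_θ⁻¹ ω)~ ψ̂(a r_θ⁻¹ ω) dμ` is finite and equal to the same invertible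
multivector `C` for almost every `ω`. -/
structure IsAdmissible {n : ℕ} (ν : Measure (SO n)) (ψ : E n → Cl n) (C : Cl n) : Prop where
  memLp : MemLp ψ 2 volume
  isUnit : IsUnit C
  integrable : ∀ᵐ ω : E n, Integrable (admissibilityIntegrand ψ ω) (muMeasure ν)
  integral_eq : ∀ᵐ ω : E n, ∫ p, admissibilityIntegrand ψ ω p ∂(muMeasure ν) = C

/-- The grade restriction on the mother wavelet and the sign `ε`: for `n ≡ 2 mod 4`, `ψ` is
even-graded and `ε = 1`, or odd-graded and `ε = -1`; for `n ≡ 3 mod 4`, `ε = 1`. -/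
def HasParity {n : ℕ} (ψ : E n → Cl n) (ε : ℤ) : Prop :=
  (n % 4 = 2 →
    (ε = 1 ∧ ∀ᵐ x : E n, ψ x ∈ CliffordAlgebra.evenOdd (Q n) 0) ∨
    (ε = -1 ∧ ∀ᵐ x : E n, ψ x ∈ CliffordAlgebra.evenOdd (Q n) 1)) ∧
  (n % 4 = 3 → ε = 1)

/-- The Clifford wavelet transform `T_ψ f(a, θ, b) = ∫ f(x) ψ_{a,θ,b}(x)~ dⁿx`. -/
def waveletTransform {n : ℕ} (ψ f : E n → Cl n) (g : SIM n) : Cl n :=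
  l2Inner f (daughter ψ g)

/-- The constant `C'_ψ = εⁿ C_ψ`. -/
def signedConstant {n : ℕ} (ε : ℤ) (C : Cl n) : Cl n := ((ε : ℝ) ^ n) • C

/-- The kernel `K_ψ(g; g') = (ψ_g C'⁻¹, ψ_{g'})`. -/
def kernel {n : ℕ} (ψ : E n → Cl n) (C' : Cl n) (g g' : SIM n) : Cl n :=
  l2Inner (fun x => daughter ψ g x * Ring.inverse C') (daughter ψ g')

end CliffordWavelet

end

open CliffordWavelet

noncomputable section

namespace CliffordWavelet

/-! ### Signs of the pseudoscalar -/

/-! The kernel is itself a reversed wavelet transform. Since $(u,v)^\sim=(v,u)$, one has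
$K_\psi(g;g')=\{T_\psi h(g)\}^\sim$ with $h=\psi_{g'}D$ and $D=(C^{-1})^\sim$. The formula is thus a
case of the orthogonality relation $\int T_\psi f\,(T_\psi h)^\sim\,d\lambda=(2\pi)^{-n}\int\widehat
f\,C\,\widehat h^\sim\,d\omega$ (`integral_waveletTransform_mul_reverse`). If $D$ commutes with
$i_n$, then $\widehat h=\widehat{\psi_{g'}}D$, so $C\widehat
h^\sim=CC^{-1}\widehat{\psi_{g'}}^\sim$, and Parseval's identity turns the right side into
$(f,\psi_{g'})=T_\psi f(g')$.

For the orthogonality relation, fix $p=(a,r)$. Parseval's identity shows that $b\mapsto T_\psi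
f(p,b)$ is, up to a constant and a sign in $b$, the Fourier integral of $\widehat f\cdot
a^{n/2}\widehat\psi(ar^{-1}\omega)^\sim$ (`waveletTransform_eq`). Parseval's identity in $b$,
Fubini, and integration over $p$ for fixed $\omega$ then place the admissibility integral, which is
$C$, between $\widehat f$ and $\widehat h^\sim$. The same computation with norms shows that the
transform is square integrable (`memLp_waveletTransform`).

The algebra does not commute, so the phase $e^{i_n\omega\cdot b}$ must be carried past
$\widehat\psi^\sim$. The grade hypothesis serves only this purpose: it gives $\psi i_n=\sigma
i_n\psi$ with $\sigma=\pm1$ (`exists_sign`). In either case $C$ commutes with $i_n$.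

Plancherel's theorem comes from the classical one: since $i_n^2=-1$ and $\widetilde{i_n}=-i_n$,
right multiplication by $i_n$ makes $Cl_n$ a complex Hilbert space. As `cft` is an $L^2$ limit fixed
only almost everywhere, its rules are proved for integrable truncations and passed to the limit. -/

theorem word_cons (n : ℕ) (a : Fin n) (t : List (Fin n)) :
    word n (a :: t) = vec n a * word n t := by simp [word]

theorem pseudoscalar_eq_word (n : ℕ) : pseudoscalar n = word n (List.finRange n) := by
  rw [pseudoscalar, word, List.ofFn_eq_map]

theorem word_mul_vec_of_notMem {n : ℕ} {l : List (Fin n)} {j : Fin n} (h : j ∉ l) :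
    word n l * vec n j = (-1 : ℝ) ^ l.length • (vec n j * word n l) := by
  induction l with
  | nil => simp [word]
  | cons a t ih =>
    simp only [List.mem_cons, not_or] at h
    rw [word_cons, mul_assoc, ih h.2, mul_smul_comm, ← mul_assoc, ← mul_assoc,
      vec_mul_vec n (Ne.symm h.1)]
    simp [pow_succ, neg_mul]

/-- All letters but $e_j$ itself anticommute with $e_j$, so the sign is that of `l.length - 1`; the
exponent `l.length + 1` has the same parity and avoids subtraction. -/
theorem word_mul_vec_of_mem {n : ℕ} {l : List (Fin n)} (hl : l.Nodup) {j : Fin n} (h : j ∈ l) :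
    word n l * vec n j = (-1 : ℝ) ^ (l.length + 1) • (vec n j * word n l) := by
  induction l with
  | nil => simp at h
  | cons a t ih =>
    rw [List.nodup_cons] at hl
    rcases eq_or_ne j a with rfl | hja
    · rw [word_cons, mul_assoc, word_mul_vec_of_notMem hl.1, mul_smul_comm]
      simp [pow_succ]
    · have hjt : j ∈ t := by simpa [hja] using h
      rw [word_cons, mul_assoc, ih hl.2 hjt, mul_smul_comm, ← mul_assoc, ← mul_assoc,
        vec_mul_vec n (Ne.symm hja)]
      simp [pow_succ, neg_mul]

/-- Reversal inverts every pair of letters, at one sign per pair. -/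
theorem word_reverse {n : ℕ} {l : List (Fin n)} (hl : l.Nodup) :
    word n l.reverse = (-1 : ℝ) ^ (l.length.choose 2) • word n l := by
  induction l with
  | nil => simp [word]
  | cons a t ih =>
    rw [List.nodup_cons] at hl
    have e' : word n (a :: t).reverse = word n t.reverse * vec n a := by simp [word]
    rw [e', ih hl.2, smul_mul_assoc, word_mul_vec_of_notMem hl.1, smul_smul, word_cons,
      List.length_cons, Nat.choose_succ_succ' _ 1, Nat.choose_one_right, ← pow_add, add_comm]

theorem odd_choose_two {n : ℕ} (hn : n % 4 = 2 ∨ n % 4 = 3) : Odd (n.choose 2) := by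
  have h := Nat.div_add_mod n 4
  rw [Nat.choose_two_right]
  set k := n / 4
  rcases hn with hn | hn
  -- $n(n-1)/2=(2k+1)(4k+1)=2(4k^2+3k)+1$.
  · refine ⟨4 * k * k + 3 * k, ?_⟩
    have e : n = 4 * k + 2 := by omega
    rw [e, Nat.add_sub_assoc (by norm_num)]
    refine Nat.div_eq_of_eq_mul_left (by norm_num) ?_
    norm_num
    ring
  -- $n(n-1)/2=(4k+3)(2k+1)=2(4k^2+5k+1)+1$.
  · refine ⟨4 * k * k + 5 * k + 1, ?_⟩
    have e : n = 4 * k + 3 := by omega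
    rw [e, Nat.add_sub_assoc (by norm_num)]
    refine Nat.div_eq_of_eq_mul_left (by norm_num) ?_
    norm_num
    ring

theorem reverse_pseudoscalar {n : ℕ} (hn : n % 4 = 2 ∨ n % 4 = 3) :
    CliffordAlgebra.reverse (pseudoscalar n) = -pseudoscalar n := by
  rw [pseudoscalar_eq_word, reverse_word, word_reverse (List.nodup_finRange n),
    List.length_finRange, (odd_choose_two hn).neg_one_pow, neg_one_smul]

theorem pseudoscalar_mul_self {n : ℕ} (hn : n % 4 = 2 ∨ n % 4 = 3) :
    pseudoscalar n * pseudoscalar n = -1 := by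
  have h := word_mul_reverse n (List.finRange n)
  rw [← reverse_word, ← pseudoscalar_eq_word, reverse_pseudoscalar hn, mul_neg] at h
  rw [← h, neg_neg]

theorem pseudoscalar_mul_ι (n : ℕ) (v : E n) :
    pseudoscalar n * CliffordAlgebra.ι (Q n) v =
      (-1 : ℝ) ^ (n + 1) • (CliffordAlgebra.ι (Q n) v * pseudoscalar n) := by
  have hv : CliffordAlgebra.ι (Q n) v = ∑ i, v i • vec n i := by
    conv_lhs => rw [← (EuclideanSpace.basisFun (Fin n) ℝ).sum_repr v]
    simp [vec]
  rw [hv, Finset.mul_sum, Finset.sum_mul, Finset.smul_sum]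
  refine Finset.sum_congr rfl fun i _ => ?_
  rw [mul_smul_comm, pseudoscalar_eq_word,
    word_mul_vec_of_mem (List.nodup_finRange n) (List.mem_finRange i), List.length_finRange,
    smul_mul_assoc, smul_comm]

/-- In odd dimension the pseudoscalar is central. -/
theorem mul_pseudoscalar_of_odd {n : ℕ} (hn : Odd n) (M : Cl n) :
    M * pseudoscalar n = pseudoscalar n * M := by
  induction M using CliffordAlgebra.induction with
  | algebraMap r => exact (Algebra.commutes r _)
  | ι v => rw [pseudoscalar_mul_ι, (hn.add_one).neg_one_pow, one_smul]
  | mul a b ha hb => rw [mul_assoc, hb, ← mul_assoc, ha, mul_assoc]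
  | add a b ha hb => rw [add_mul, mul_add, ha, hb]

theorem ι_mul_pseudoscalar_of_even {n : ℕ} (hn : Even n) (v : E n) :
    CliffordAlgebra.ι (Q n) v * pseudoscalar n = -(pseudoscalar n * CliffordAlgebra.ι (Q n) v) := by
  rw [pseudoscalar_mul_ι, (hn.add_one).neg_one_pow, neg_one_smul, neg_neg]

theorem mul_pseudoscalar_of_mem_even {n : ℕ} (hn : Even n) {M : Cl n}
    (hM : M ∈ CliffordAlgebra.evenOdd (Q n) 0) :
    M * pseudoscalar n = pseudoscalar n * M := by
  induction M, hM using CliffordAlgebra.even_induction with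
  | algebraMap r => exact (Algebra.commutes r _)
  | add _ _ _ _ ha hb => rw [add_mul, mul_add, ha, hb]
  | ι_mul_ι_mul v w x _ hx =>
    rw [mul_assoc, hx, ← mul_assoc, mul_assoc (CliffordAlgebra.ι (Q n) v),
      ι_mul_pseudoscalar_of_even hn w, mul_neg, ← mul_assoc, ι_mul_pseudoscalar_of_even hn v]
    simp [mul_assoc]

theorem mul_pseudoscalar_of_mem_odd {n : ℕ} (hn : Even n) {M : Cl n}
    (hM : M ∈ CliffordAlgebra.evenOdd (Q n) 1) :
    M * pseudoscalar n = -(pseudoscalar n * M) := by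
  induction M, hM using CliffordAlgebra.odd_induction with
  | ι v => exact ι_mul_pseudoscalar_of_even hn v
  | add _ _ _ _ ha hb => rw [add_mul, mul_add, ha, hb, neg_add]
  | ι_mul_ι_mul v w x _ hx =>
    rw [mul_assoc, hx, mul_neg, ← mul_assoc, mul_assoc (CliffordAlgebra.ι (Q n) v),
      ι_mul_pseudoscalar_of_even hn w, mul_neg, ← mul_assoc, ι_mul_pseudoscalar_of_even hn v]
    simp [mul_assoc]

/-! ### Norm and inner product -/

theorem inner_eq_scalarPart {n : ℕ} (M N : Cl n) :
    inner ℝ M N = scalarPart n (M * CliffordAlgebra.reverse N) := rfl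

/-- Associativity makes right multiplication by $\widetilde N$ the adjoint of right multiplication
by $N$. -/
theorem inner_mul_left_eq {n : ℕ} (M N P : Cl n) :
    inner ℝ (M * N) P = inner ℝ M (P * CliffordAlgebra.reverse N) := by
  simp only [inner_eq_scalarPart, CliffordAlgebra.reverse.map_mul, CliffordAlgebra.reverse_reverse,
    mul_assoc]

theorem inner_mul_reverse_left {n : ℕ} (M N P : Cl n) :
    inner ℝ (M * CliffordAlgebra.reverse N) P = inner ℝ M (P * N) := by
  rw [inner_mul_left_eq, CliffordAlgebra.reverse_reverse]

/-- Multiplication in the Clifford algebra, as a continuous bilinear map. -/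
def mulL (n : ℕ) : Cl n →L[ℝ] Cl n →L[ℝ] Cl n := (LinearMap.mul ℝ (Cl n)).toContinuousBilinearMap

@[simp] theorem mulL_apply {n : ℕ} (M N : Cl n) : mulL n M N = M * N := rfl

/-- Reversion, as a continuous linear equivalence. -/
def revL (n : ℕ) : Cl n ≃L[ℝ] Cl n :=
  (CliffordAlgebra.reverseEquiv (Q := Q n)).toContinuousLinearEquiv

@[simp] theorem revL_apply {n : ℕ} (M : Cl n) : revL n M = CliffordAlgebra.reverse M := rfl

/-- Right multiplication by a fixed multivector. -/
def mulRightL {n : ℕ} (D : Cl n) : Cl n →L[ℝ] Cl n := (mulL n).flip D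

@[simp] theorem mulRightL_apply {n : ℕ} (M D : Cl n) : mulRightL D M = M * D := rfl

/-- The modulus is not submultiplicative in general; continuity comes from finite dimension, and
estimates carry the constant `‖mulL n‖`. -/
instance instContinuousMulCl (n : ℕ) : ContinuousMul (Cl n) :=
  ⟨(mulL n).continuous₂⟩

/-! ### The exponential -/

theorem expI_zero (n : ℕ) : expI n 0 = 1 := by simp [expI]

theorem expI_add {n : ℕ} (hn : n % 4 = 2 ∨ n % 4 = 3) (s t : ℝ) :
    expI n (s + t) = expI n s * expI n t := by
  simp only [expI, Real.cos_add, Real.sin_add, add_mul, mul_add, smul_mul_assoc, mul_smul_comm,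
    one_mul, mul_one, pseudoscalar_mul_self hn]
  module

theorem reverse_expI {n : ℕ} (hn : n % 4 = 2 ∨ n % 4 = 3) (t : ℝ) :
    CliffordAlgebra.reverse (expI n t) = expI n (-t) := by
  simp [expI, reverse_pseudoscalar hn]

theorem continuous_expI (n : ℕ) : Continuous (expI n) := by
  unfold expI; fun_prop

theorem expI_comm {n : ℕ} {D : Cl n} (hD : D * pseudoscalar n = pseudoscalar n * D) (t : ℝ) :
    expI n t * D = D * expI n t := by
  simp [expI, add_mul, mul_add, hD]

/-- The embedding of the complex numbers into the Clifford algebra sending `I` to `i_n`. -/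
def ofComplex (n : ℕ) (z : ℂ) : Cl n := z.re • (1 : Cl n) + z.im • pseudoscalar n

theorem ofComplex_mul {n : ℕ} (hn : n % 4 = 2 ∨ n % 4 = 3) (z w : ℂ) :
    ofComplex n (z * w) = ofComplex n z * ofComplex n w := by
  simp only [ofComplex, Complex.mul_re, Complex.mul_im, add_mul, mul_add, smul_mul_assoc,
    mul_smul_comm, one_mul, mul_one, pseudoscalar_mul_self hn]
  module

theorem ofComplex_mul_reverse {n : ℕ} (hn : n % 4 = 2 ∨ n % 4 = 3) (z : ℂ) :
    ofComplex n z * CliffordAlgebra.reverse (ofComplex n z) = (‖z‖ ^ 2) • (1 : Cl n) := by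
  rw [Complex.sq_norm, Complex.normSq_apply]
  simp only [ofComplex, map_add, map_smul, CliffordAlgebra.reverse.map_one,
    reverse_pseudoscalar hn, add_mul, mul_add, smul_mul_assoc,
    mul_smul_comm, one_mul, mul_one, mul_neg, pseudoscalar_mul_self hn]
  module

/-- The adjoint of right multiplication by $z$ is right multiplication by $\widetilde z$, and
$z\widetilde z=|z|^2$. This is what makes the modulus a complex norm. -/
theorem norm_mul_ofComplex {n : ℕ} (hn : n % 4 = 2 ∨ n % 4 = 3) (M : Cl n) (z : ℂ) :
    ‖M * ofComplex n z‖ = ‖z‖ * ‖M‖ := by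
  have h : ‖M * ofComplex n z‖ ^ 2 = (‖z‖ * ‖M‖) ^ 2 := by
    rw [← real_inner_self_eq_norm_sq, inner_mul_left_eq, mul_assoc, ofComplex_mul_reverse hn,
      mul_smul_comm, mul_one, inner_smul_right, real_inner_self_eq_norm_sq, mul_pow]
  exact (pow_left_inj₀ (norm_nonneg _) (by positivity) two_ne_zero).1 h

theorem expI_eq_ofComplex (n : ℕ) (t : ℝ) :
    expI n t = ofComplex n (Complex.exp (t * Complex.I)) := by
  simp [expI, ofComplex, Complex.exp_ofReal_mul_I_re, Complex.exp_ofReal_mul_I_im]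

theorem norm_mul_expI {n : ℕ} (hn : n % 4 = 2 ∨ n % 4 = 3) (M : Cl n) (t : ℝ) :
    ‖M * expI n t‖ = ‖M‖ := by
  rw [expI_eq_ofComplex, norm_mul_ofComplex hn, Complex.norm_exp_ofReal_mul_I, one_mul]

/-! ### Plancherel's theorem for the Clifford Fourier integral -/

section FourierIntegral

open FourierTransform SchwartzMap
open scoped ContDiff

variable {V F : Type*} [NormedAddCommGroup V] [InnerProductSpace ℝ V] [FiniteDimensional ℝ V]
  [MeasurableSpace V] [BorelSpace V] [NormedAddCommGroup F] [InnerProductSpace ℂ F]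
 

theorem continuous_fourier {f : V → F} (hf : Integrable f) : Continuous (𝓕 f) :=
  VectorFourier.fourierIntegral_continuous Real.continuous_fourierChar
    (by exact continuous_inner) hf

variable [CompleteSpace F]

/-- On `L¹ ∩ L²`, the Fourier integral represents the `L²` Fourier transform. -/
theorem fourier_ae_eq_fourier_toLp {f : V → F} (hf : Integrable f) (hf2 : MemLp f 2) :
    𝓕 f =ᵐ[volume] (𝓕 (hf2.toLp f) : Lp F 2 (volume : Measure V)) := by
  -- Both sides are locally integrable, so testing against smooth compactly supported functions
  -- suffices. On the $L^2$ side the pairing is that of the Fourier transform of a tempered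
  -- distribution.
  apply ae_eq_of_integral_contDiff_smul_eq (continuous_fourier hf).locallyIntegrable
    ((Lp.memLp _).locallyIntegrable (by norm_num))
  intro g g_smooth g_cpt
  have hg₁ : HasCompactSupport (Complex.ofRealCLM ∘ g) := g_cpt.comp_left rfl
  have hg₂ : ContDiff ℝ ∞ (Complex.ofRealCLM ∘ g) := by fun_prop
  set s : 𝓢(V, ℂ) := hg₁.toSchwartzMap hg₂ with hs
  have h1 := DFunLike.congr_fun (Lp.fourier_toTemperedDistribution_eq (hf2.toLp f)) s
  rw [TemperedDistribution.fourier_apply, Lp.toTemperedDistribution_apply,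
    Lp.toTemperedDistribution_apply] at h1
  have h2 : ∫ x, (𝓕 s) x • (hf2.toLp f) x = ∫ x, 𝓕 (s : V → ℂ) x • f x := by
    apply integral_congr_ae
    filter_upwards [hf2.coeFn_toLp] with x hx
    rw [hx, SchwartzMap.fourier_coe]
  -- The Fourier integral is self-adjoint for the bilinear pairing, by Fubini.
  have h3 : ∫ x, 𝓕 (s : V → ℂ) x • f x = ∫ x, s x • 𝓕 f x := by
    have := VectorFourier.integral_fourierIntegral_smul_eq_flip (μ := (volume : Measure V))
      (ν := (volume : Measure V)) (L := innerₗ V) (f := (s : V → ℂ)) (g := f)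
      Real.continuous_fourierChar (by exact continuous_inner) s.integrable hf
    rw [flip_innerₗ] at this
    exact this
  have h4 : ∀ x, g x • 𝓕 f x = s x • 𝓕 f x := fun x => by simp [hs]
  have h5 : ∀ x, g x • (𝓕 (hf2.toLp f) : Lp F 2 (volume : Measure V)) x =
    s x • (𝓕 (hf2.toLp f) : Lp F 2 (volume : Measure V)) x := fun x => by simp [hs]
  simp_rw [h4, h5]
  rw [← h1, h2, h3]

/-- The difference is the $L^2$ transform of $f-u$, which is an isometry. Leaving $u$ arbitrary
covers both the truncations and $u=0$. -/
theorem eLpNorm_fourier_sub {f u : V → F} (hf : MemLp f 2) (hu : Integrable u)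
    (hu2 : MemLp u 2) :
    eLpNorm (⇑(𝓕 (hf.toLp f) : Lp F 2 (volume : Measure V)) - 𝓕 u) 2 volume =
      eLpNorm (f - u) 2 volume := by
  have h1 : (⇑(𝓕 (hf.toLp f) : Lp F 2 (volume : Measure V)) - 𝓕 u) =ᵐ[volume]
      ⇑(𝓕 ((hf.sub hu2).toLp (f - u)) : Lp F 2 (volume : Measure V)) := by
    have h2 : (𝓕 ((hf.sub hu2).toLp (f - u)) : Lp F 2 (volume : Measure V)) =
        𝓕 (hf.toLp f) - 𝓕 (hu2.toLp u) := by
      rw [MemLp.toLp_sub hf hu2]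
      exact (Lp.fourierTransformₗᵢ V F).map_sub _ _
    rw [h2]
    refine EventuallyEq.trans ?_ (Lp.coeFn_sub _ _).symm
    exact EventuallyEq.rfl.sub (fourier_ae_eq_fourier_toLp hu hu2)
  rw [eLpNorm_congr_ae h1, ← Lp.enorm_def, ← eLpNorm_congr_ae (hf.sub hu2).coeFn_toLp,
    ← Lp.enorm_def]
  simp only [← ofReal_norm, Lp.norm_fourier_eq]

end FourierIntegral

/-- The Clifford algebra, regarded as a complex vector space on which `I` acts as right
multiplication by the pseudoscalar. -/
def ComplexCl (n : ℕ) : Type := Cl n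

/-! ### The complex Hilbert space structure on the Clifford algebra -/

namespace ComplexCl

variable {n : ℕ}

instance : NormedAddCommGroup (ComplexCl n) := inferInstanceAs (NormedAddCommGroup (Cl n))

/-- The underlying multivector. -/
def toCl (M : ComplexCl n) : Cl n := M

instance [hn : Fact (n % 4 = 2 ∨ n % 4 = 3)] : Module ℂ (ComplexCl n) where
  smul z M := M.toCl * ofComplex n z
  one_smul M := by
    change M.toCl * ofComplex n 1 = M.toCl
    simp [ofComplex]
  mul_smul z w M := by
    change M.toCl * ofComplex n (z * w) = M.toCl * ofComplex n w * ofComplex n z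
    rw [mul_comm z w, ofComplex_mul hn.out, mul_assoc]
  smul_zero z := zero_mul (ofComplex n z)
  smul_add z M N := add_mul M.toCl N.toCl (ofComplex n z)
  add_smul z w M := by
    change M.toCl * ofComplex n (z + w) = M.toCl * ofComplex n z + M.toCl * ofComplex n w
    rw [← mul_add]
    congr 1
    simp only [ofComplex, Complex.add_re, Complex.add_im]
    module
  zero_smul M := by
    change M.toCl * ofComplex n 0 = 0
    simp [ofComplex]

variable [hn : Fact (n % 4 = 2 ∨ n % 4 = 3)]

instance : NormedSpace ℂ (ComplexCl n) where
  norm_smul_le z M := (norm_mul_ofComplex hn.out M.toCl z).le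

/-- The norm is still the modulus, so the parallelogram law holds and the complex inner product is
recovered by polarization. -/
instance : InnerProductSpace ℂ (ComplexCl n) :=
  InnerProductSpace.ofNorm ℂ fun x y => by
    have h := parallelogram_law_with_norm ℝ x.toCl y.toCl
    simp only [pow_two] at h
    exact h

instance : CompleteSpace (ComplexCl n) :=
  FiniteDimensional.complete ℝ (Cl n)

variable (n) in
/-- The identity map, as a real-linear isometric equivalence. -/
def equiv : Cl n ≃ₗᵢ[ℝ] ComplexCl n where
  toFun M := M
  invFun M := M
  map_add' _ _ := rfl
  map_smul' r M := by
    have h : r • M = M * ofComplex n (r : ℂ) := by simp [ofComplex]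
    exact h
  left_inv _ := rfl
  right_inv _ := rfl
  norm_map' _ := rfl

theorem equiv_mul_ofComplex (M : Cl n) (z : ℂ) : equiv n (M * ofComplex n z) = z • equiv n M := rfl

/-- The classical kernel is $e^{-2\pi i\,\omega\cdot x}$, hence the rescaling of the frequency by
$(2\pi)^{-1}$. -/
theorem equiv_cftIntegral (f : E n → Cl n) (ω : E n) :
    equiv n (cftIntegral f ω) =
      FourierTransform.fourier (fun x => equiv n (f x)) ((2 * Real.pi)⁻¹ • ω) := by
  rw [Real.fourier_eq', cftIntegral]
  have := (equiv n).toContinuousLinearEquiv.integral_comp_comm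
    (μ := (volume : Measure (E n))) (fun x => f x * expI n (-(inner ℝ ω x)))
  refine this.symm.trans ?_
  congr 1
  ext x
  change equiv n _ = _
  rw [expI_eq_ofComplex, equiv_mul_ofComplex, inner_smul_right, real_inner_comm]
  congr 4
  field_simp

end ComplexCl

/-- The factor `(2π)^{n/2}` by which the Clifford Fourier transform scales the `L²` norm. -/
def plancherelFactor (n : ℕ) : ENNReal := ENNReal.ofReal ((2 * Real.pi) ^ n) ^ (1 / 2 : ℝ)

theorem plancherelFactor_ne_top (n : ℕ) : plancherelFactor n ≠ ⊤ := by
  simp [plancherelFactor]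

theorem eLpNorm_comp_smul {G : Type*} [NormedAddCommGroup G] {n : ℕ} (g : E n → G) :
    eLpNorm (fun ω => g ((2 * Real.pi)⁻¹ • ω)) 2 volume =
      plancherelFactor n * eLpNorm g 2 volume := by
  have h0 : (2 * Real.pi)⁻¹ ≠ 0 := by positivity
  have h := (Homeomorph.smulOfNeZero _ h0).measurableEmbedding.eLpNorm_map_measure
    (μ := (volume : Measure (E n))) (p := 2) (g := g)
  have h2 : (volume : Measure (E n)).map (Homeomorph.smulOfNeZero _ h0) =
      ENNReal.ofReal ((2 * Real.pi) ^ n) • volume := by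
    refine (Measure.map_addHaar_smul _ h0).trans ?_
    simp only [finrank_euclideanSpace, Fintype.card_fin, inv_pow, inv_inv]
    rw [abs_of_pos (by positivity)]
  rw [h2, eLpNorm_smul_measure_of_ne_top (by simp)] at h
  simp only [smul_eq_mul, one_div, ENNReal.toReal_inv, ENNReal.toReal_ofNat] at h
  rw [plancherelFactor, one_div]
  exact h.symm

/-- Plancherel's theorem. -/
theorem exists_eLpNorm_sub_cftIntegral {n : ℕ} (hn : n % 4 = 2 ∨ n % 4 = 3) {f : E n → Cl n}
    (hf : MemLp f 2 volume) :
    ∃ φ : E n → Cl n, MemLp φ 2 volume ∧ ∀ u : E n → Cl n, Integrable u → MemLp u 2 volume →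
      eLpNorm (φ - cftIntegral u) 2 volume = plancherelFactor n * eLpNorm (f - u) 2 volume := by
  have : Fact (n % 4 = 2 ∨ n % 4 = 3) := ⟨hn⟩
  set e := ComplexCl.equiv n
  have hm : ∀ {u : E n → Cl n}, MemLp u 2 volume → MemLp (fun x => e (u x)) 2 volume :=
    fun hu => e.toContinuousLinearEquiv.toContinuousLinearMap.comp_memLp' hu
  set Φ := (FourierTransform.fourier ((hm hf).toLp _) :
    Lp (ComplexCl n) 2 (volume : Measure (E n)))
  have key : ∀ u : E n → Cl n, Integrable u → MemLp u 2 volume →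
      eLpNorm ((fun ω => e.symm (Φ ((2 * Real.pi)⁻¹ • ω))) - cftIntegral u) 2 volume =
        plancherelFactor n * eLpNorm (f - u) 2 volume := by
    intro u hu hu2
    have h1 := eLpNorm_fourier_sub (hm hf)
      (e.toContinuousLinearEquiv.toContinuousLinearMap.integrable_comp hu) (hm hu2)
    have h2 := eLpNorm_comp_smul (⇑Φ - FourierTransform.fourier (fun x => e (u x)))
    have h3 : eLpNorm (f - u) 2 volume =
        eLpNorm ((fun x => e (f x)) - (fun x => e (u x))) 2 volume := by
      refine eLpNorm_congr_norm_ae (Eventually.of_forall fun x => ?_)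
      simp only [Pi.sub_apply, ← map_sub, LinearIsometryEquiv.norm_map]
    rw [h3]
    refine Eq.trans ?_ (h2.trans (congrArg _ h1))
    refine eLpNorm_congr_norm_ae (Eventually.of_forall fun ω => ?_)
    simp only [Pi.sub_apply]
    rw [← e.norm_map, map_sub, e.apply_symm_apply, ComplexCl.equiv_cftIntegral]
  refine ⟨fun ω => e.symm (Φ ((2 * Real.pi)⁻¹ • ω)), ⟨?_, ?_⟩, key⟩
  · refine e.symm.continuous.comp_aestronglyMeasurable ?_
    have h0 : (2 * Real.pi)⁻¹ ≠ 0 := by positivity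
    exact (Lp.memLp Φ).1.comp_quasiMeasurePreserving
      (Measure.quasiMeasurePreserving_smul volume h0)
  -- The case $u=0$ is Plancherel's identity and bounds the norm.
  · have h := key 0 (integrable_zero _ _ _) MemLp.zero
    have h0 : cftIntegral (0 : E n → Cl n) = 0 := by ext; simp [cftIntegral]
    rw [h0, sub_zero, sub_zero] at h
    rw [h]
    exact ENNReal.mul_lt_top (plancherelFactor_ne_top n).lt_top hf.2

/-! ### The Clifford Fourier transform on `L²` -/

theorem eLpNorm_two_sq {α G : Type*} [MeasurableSpace α] [NormedAddCommGroup G] (μ : Measure α)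
    (f : α → G) : eLpNorm f 2 μ ^ 2 = ∫⁻ x, ‖f x‖ₑ ^ 2 ∂μ := by
  have h := eLpNorm_nnreal_pow_eq_lintegral (μ := μ) (f := f) (p := 2) two_ne_zero
  simpa using h

theorem integral_norm_sq_eq {α G : Type*} [MeasurableSpace α] [NormedAddCommGroup G]
    {μ : Measure α} {f : α → G} (hf : AEStronglyMeasurable f μ) :
    ∫ x, ‖f x‖ ^ 2 ∂μ = (eLpNorm f 2 μ ^ 2).toReal := by
  have hm : AEStronglyMeasurable (fun x => ‖f x‖ ^ 2) μ := hf.norm.pow 2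
  rw [eLpNorm_two_sq,
    integral_eq_lintegral_of_nonneg_ae (Eventually.of_forall fun x => by positivity) hm]
  congr 2
  ext x
  rw [ENNReal.ofReal_pow (norm_nonneg _), ofReal_norm]

variable {n : ℕ}

/-- The truncation of `f` to the ball of radius `R`. -/
def truncate (f : E n → Cl n) (R : ℝ) : E n → Cl n := (Metric.closedBall (0 : E n) R).indicator f

theorem memLp_truncate {f : E n → Cl n} (hf : MemLp f 2 volume) (R : ℝ) :
    MemLp (truncate f R) 2 volume :=
  hf.indicator Metric.isClosed_closedBall.measurableSet

theorem integrable_truncate {f : E n → Cl n} (hf : MemLp f 2 volume) (R : ℝ) :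
    Integrable (truncate f R) := by
  rw [truncate, integrable_indicator_iff Metric.isClosed_closedBall.measurableSet]
  have : IsFiniteMeasure (volume.restrict (Metric.closedBall (0 : E n) R)) :=
    ⟨by simpa using measure_closedBall_lt_top⟩
  exact (hf.restrict _).integrable (by norm_num)

theorem tendsto_eLpNorm_sub_truncate {f : E n → Cl n} (hf : MemLp f 2 volume) :
    Tendsto (fun R : ℝ => eLpNorm (f - truncate f R) 2 volume) atTop (𝓝 0) := by
  have h : Tendsto (fun R : ℝ => ∫⁻ x, ‖(f - truncate f R) x‖ₑ ^ 2) atTop (𝓝 (∫⁻ _ : E n, 0)) := by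
    refine tendsto_lintegral_filter_of_dominated_convergence' (fun x => ‖f x‖ₑ ^ 2)
      (Eventually.of_forall fun R => ?_) (Eventually.of_forall fun R => ae_of_all _ fun x => ?_) ?_
      (ae_of_all _ fun x => ?_)
    · exact ((hf.1.sub (memLp_truncate hf R).1).enorm.pow_const 2)
    · by_cases hx : x ∈ Metric.closedBall (0 : E n) R <;> simp [truncate, hx]
    · rw [← eLpNorm_two_sq]
      exact (ENNReal.pow_lt_top hf.2).ne
    · refine tendsto_const_nhds.congr' ?_
      filter_upwards [eventually_ge_atTop ‖x‖] with R hR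
      simp [truncate, hR]
  rw [lintegral_zero] at h
  simp_rw [← eLpNorm_two_sq] at h
  have h2 := h.ennrpow_const (1 / 2 : ℝ)
  rw [ENNReal.zero_rpow_of_pos (by norm_num)] at h2
  refine h2.congr fun R => ?_
  rw [← ENNReal.rpow_natCast, ← ENNReal.rpow_mul]
  norm_num

theorem integrable_mul_expI (hn : n % 4 = 2 ∨ n % 4 = 3) {u : E n → Cl n} (hu : Integrable u)
    {t : E n → ℝ} (ht : Continuous t) : Integrable (fun x => u x * expI n (t x)) :=
  hu.mono (hu.1.mul ((continuous_expI n).comp ht).aestronglyMeasurable)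
    (ae_of_all _ fun _ => (norm_mul_expI hn _ _).le)

theorem continuous_cftIntegral (hn : n % 4 = 2 ∨ n % 4 = 3) {u : E n → Cl n} (hu : Integrable u) :
    Continuous (cftIntegral u) := by
  refine continuous_of_dominated (bound := fun x => ‖u x‖) (fun ω => ?_) (fun ω => ?_) hu.norm ?_
  · exact (integrable_mul_expI hn hu (by fun_prop)).1
  · exact ae_of_all _ fun x => (norm_mul_expI hn _ _).le
  · refine ae_of_all _ fun x => continuous_const.mul ((continuous_expI n).comp (by fun_prop))

theorem ae_eq_of_tendsto_eLpNorm {α G ι : Type*} [MeasurableSpace α] [NormedAddCommGroup G]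
    {μ : Measure α} {l : Filter ι} [l.NeBot] {φ χ : α → G} {w : ι → α → G}
    (hφ : AEStronglyMeasurable φ μ) (hχ : AEStronglyMeasurable χ μ)
    (hw : ∀ k, AEStronglyMeasurable (w k) μ)
    (h1 : Tendsto (fun k => eLpNorm (φ - w k) 2 μ) l (𝓝 0))
    (h2 : Tendsto (fun k => eLpNorm (χ - w k) 2 μ) l (𝓝 0)) : φ =ᵐ[μ] χ := by
  have h3 := h1.add h2
  rw [add_zero] at h3
  have h4 : eLpNorm (φ - χ) 2 μ ≤ 0 := by
    refine ge_of_tendsto h3 (Eventually.of_forall fun k => ?_)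
    have e : φ - χ = (φ - w k) - (χ - w k) := by abel
    rw [e]
    exact eLpNorm_sub_le (hφ.sub (hw k)) (hχ.sub (hw k)) (by norm_num)
  have h5 := (eLpNorm_eq_zero_iff (hφ.sub hχ) two_ne_zero).1 (le_antisymm h4 bot_le)
  filter_upwards [h5] with x hx
  exact sub_eq_zero.1 hx

/-- The Plancherel transform of $f$ is a limit of the truncated Fourier integrals, so the choice in
`cft` is not the default `0`; by uniqueness of $L^2$ limits it agrees with that transform almost
everywhere. -/
theorem memLp_cft_and_eLpNorm (hn : n % 4 = 2 ∨ n % 4 = 3) {f : E n → Cl n}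
    (hf : MemLp f 2 volume) :
    MemLp (cft f) 2 volume ∧ ∀ u : E n → Cl n, Integrable u → MemLp u 2 volume →
      eLpNorm (cft f - cftIntegral u) 2 volume = plancherelFactor n * eLpNorm (f - u) 2 volume := by
  obtain ⟨φ, hφ, hφu⟩ := exists_eLpNorm_sub_cftIntegral hn hf
  have hlim : Tendsto (fun R : ℝ => eLpNorm (φ - cftIntegral (truncate f R)) 2 volume)
      atTop (𝓝 0) := by
    have h := ENNReal.Tendsto.const_mul (a := plancherelFactor n) (tendsto_eLpNorm_sub_truncate hf)
      (Or.inr (plancherelFactor_ne_top n))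
    rw [mul_zero] at h
    exact h.congr fun R => (hφu _ (integrable_truncate hf R) (memLp_truncate hf R)).symm
  have hex : ∃ φ, IsCFT f φ := ⟨φ, hφ, hlim⟩
  have hc : IsCFT f (cft f) := by
    rw [cft, dif_pos hex]; exact hex.choose_spec
  have hae : cft f =ᵐ[volume] φ := ae_eq_of_tendsto_eLpNorm hc.1.1 hφ.1
    (fun R => (continuous_cftIntegral hn (integrable_truncate hf R)).aestronglyMeasurable)
    hc.2 hlim
  exact ⟨hc.1, fun u hu hu2 =>
    (eLpNorm_congr_ae (hae.sub EventuallyEq.rfl)).trans (hφu u hu hu2)⟩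

theorem memLp_cft (hn : n % 4 = 2 ∨ n % 4 = 3) {f : E n → Cl n} (hf : MemLp f 2 volume) :
    MemLp (cft f) 2 volume := (memLp_cft_and_eLpNorm hn hf).1

theorem eLpNorm_cft_sub_cftIntegral (hn : n % 4 = 2 ∨ n % 4 = 3) {f u : E n → Cl n}
    (hf : MemLp f 2 volume) (hu : Integrable u) (hu2 : MemLp u 2 volume) :
    eLpNorm (cft f - cftIntegral u) 2 volume = plancherelFactor n * eLpNorm (f - u) 2 volume :=
  (memLp_cft_and_eLpNorm hn hf).2 u hu hu2

theorem tendsto_eLpNorm_cft_sub (hn : n % 4 = 2 ∨ n % 4 = 3) {ι : Type*} {l : Filter ι}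
    {f : E n → Cl n} (hf : MemLp f 2 volume) {u : ι → E n → Cl n}
    (hu : ∀ k, Integrable (u k)) (hu2 : ∀ k, MemLp (u k) 2 volume)
    (h : Tendsto (fun k => eLpNorm (f - u k) 2 volume) l (𝓝 0)) :
    Tendsto (fun k => eLpNorm (cft f - cftIntegral (u k)) 2 volume) l (𝓝 0) := by
  have h' := ENNReal.Tendsto.const_mul (a := plancherelFactor n) h
    (Or.inr (plancherelFactor_ne_top n))
  rw [mul_zero] at h'
  exact h'.congr fun k => (eLpNorm_cft_sub_cftIntegral hn hf (hu k) (hu2 k)).symm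

/-- The tool for identifying a transform: any approximation in $L^1\cap L^2$ may replace the
truncations, by Plancherel. -/
theorem cft_ae_eq_of_tendsto (hn : n % 4 = 2 ∨ n % 4 = 3) {ι : Type*} {l : Filter ι} [l.NeBot]
    {f φ : E n → Cl n} (hf : MemLp f 2 volume) (hφ : AEStronglyMeasurable φ volume)
    {u : ι → E n → Cl n} (hu : ∀ k, Integrable (u k)) (hu2 : ∀ k, MemLp (u k) 2 volume)
    (h : Tendsto (fun k => eLpNorm (f - u k) 2 volume) l (𝓝 0))
    (h' : Tendsto (fun k => eLpNorm (φ - cftIntegral (u k)) 2 volume) l (𝓝 0)) :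
    cft f =ᵐ[volume] φ :=
  ae_eq_of_tendsto_eLpNorm (memLp_cft hn hf).1 hφ
    (fun k => (continuous_cftIntegral hn (hu k)).aestronglyMeasurable)
    (tendsto_eLpNorm_cft_sub hn hf hu hu2 h) h'

theorem cft_ae_eq_cftIntegral (hn : n % 4 = 2 ∨ n % 4 = 3) {f : E n → Cl n} (hf : Integrable f)
    (hf2 : MemLp f 2 volume) : cft f =ᵐ[volume] cftIntegral f := by
  refine cft_ae_eq_of_tendsto hn (l := (atTop : Filter ℕ)) (u := fun _ => f) hf2
    (continuous_cftIntegral hn hf).aestronglyMeasurable (fun _ => hf) (fun _ => hf2) ?_ ?_ <;> simp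

theorem eLpNorm_cft (hn : n % 4 = 2 ∨ n % 4 = 3) {f : E n → Cl n} (hf : MemLp f 2 volume) :
    eLpNorm (cft f) 2 volume = plancherelFactor n * eLpNorm f 2 volume := by
  have h := eLpNorm_cft_sub_cftIntegral hn hf (integrable_zero _ _ _) MemLp.zero
  have h0 : cftIntegral (0 : E n → Cl n) = 0 := by ext; simp [cftIntegral]
  change eLpNorm (cft f - cftIntegral (0 : E n → Cl n)) 2 volume =
    plancherelFactor n * eLpNorm (f - 0) 2 volume at h
  rwa [h0, sub_zero, sub_zero] at h

theorem cft_congr_ae (hn : n % 4 = 2 ∨ n % 4 = 3) {f g : E n → Cl n} (hf : MemLp f 2 volume)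
    (hfg : f =ᵐ[volume] g) : cft f =ᵐ[volume] cft g := by
  have hg := (memLp_congr_ae hfg).1 hf
  refine cft_ae_eq_of_tendsto hn hf (memLp_cft hn hg).1 (integrable_truncate hg)
    (memLp_truncate hg) ?_ (tendsto_eLpNorm_cft_sub hn hg (integrable_truncate hg)
    (memLp_truncate hg) (tendsto_eLpNorm_sub_truncate hg))
  exact (tendsto_eLpNorm_sub_truncate hg).congr fun R =>
    (eLpNorm_congr_ae (hfg.sub EventuallyEq.rfl)).symm

theorem tendsto_eLpNorm_clm_comp {ι : Type*} {l : Filter ι} (A : Cl n →L[ℝ] Cl n)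
    {w : ι → E n → Cl n} (h : Tendsto (fun k => eLpNorm (w k) 2 volume) l (𝓝 0)) :
    Tendsto (fun k => eLpNorm (fun x => A (w k x)) 2 volume) l (𝓝 0) := by
  have h' := ENNReal.Tendsto.const_mul (a := ENNReal.ofReal ‖A‖) h (Or.inr ENNReal.ofReal_ne_top)
  rw [mul_zero] at h'
  exact tendsto_of_tendsto_of_tendsto_of_le_of_le tendsto_const_nhds h' (fun _ => bot_le)
    fun k => eLpNorm_le_mul_eLpNorm_of_ae_le_mul (ae_of_all _ fun x => A.le_opNorm _) 2

/-- The Clifford Fourier transform commutes with every linear map that commutes with right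
multiplication by the exponentials. -/
theorem cft_clm_comp (hn : n % 4 = 2 ∨ n % 4 = 3) {f : E n → Cl n} (hf : MemLp f 2 volume)
    (A : Cl n →L[ℝ] Cl n) (hA : ∀ M t, A (M * expI n t) = A M * expI n t) :
    cft (fun x => A (f x)) =ᵐ[volume] fun ω => A (cft f ω) := by
  have hc : ∀ {u : E n → Cl n}, Integrable u →
      cftIntegral (fun x => A (u x)) = fun ω => A (cftIntegral u ω) := by
    intro u hu
    ext ω
    simp only [cftIntegral, ← hA]
    exact A.integral_comp_comm (integrable_mul_expI hn hu (by fun_prop))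
  refine cft_ae_eq_of_tendsto hn (A.comp_memLp' hf) (A.comp_memLp' (memLp_cft hn hf)).1
    (u := fun R x => A (truncate f R x)) (l := atTop)
    (fun R => A.integrable_comp (integrable_truncate hf R))
    (fun R => A.comp_memLp' (memLp_truncate hf R)) ?_ ?_
  · refine (tendsto_eLpNorm_clm_comp A (tendsto_eLpNorm_sub_truncate hf)).congr fun R => ?_
    congr 1; ext x; simp
  · refine (tendsto_eLpNorm_clm_comp A (tendsto_eLpNorm_cft_sub hn hf (integrable_truncate hf)
      (memLp_truncate hf) (tendsto_eLpNorm_sub_truncate hf))).congr fun R => ?_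
    rw [hc (integrable_truncate hf R)]
    congr 1; ext x; simp

theorem cft_const_mul (hn : n % 4 = 2 ∨ n % 4 = 3) {f : E n → Cl n} (hf : MemLp f 2 volume)
    (M : Cl n) : cft (fun x => M * f x) =ᵐ[volume] fun ω => M * cft f ω :=
  cft_clm_comp hn hf (mulL n M) fun N t => by simp [mul_assoc]

theorem cft_mul_const (hn : n % 4 = 2 ∨ n % 4 = 3) {f : E n → Cl n} (hf : MemLp f 2 volume)
    {D : Cl n} (hD : D * pseudoscalar n = pseudoscalar n * D) :
    cft (fun x => f x * D) =ᵐ[volume] fun ω => cft f ω * D :=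
  cft_clm_comp hn hf (mulRightL D) fun N t => by
    simp only [mulRightL_apply, mul_assoc, expI_comm hD]

theorem cft_add (hn : n % 4 = 2 ∨ n % 4 = 3) {f g : E n → Cl n} (hf : MemLp f 2 volume)
    (hg : MemLp g 2 volume) : cft (f + g) =ᵐ[volume] cft f + cft g := by
  have hsplit : ∀ {φ χ : E n → Cl n} {w v : ℝ → E n → Cl n}, AEStronglyMeasurable φ volume →
      AEStronglyMeasurable χ volume → (∀ k, AEStronglyMeasurable (w k) volume) →
      (∀ k, AEStronglyMeasurable (v k) volume) →
      Tendsto (fun k => eLpNorm (φ - w k) 2 volume) atTop (𝓝 0) →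
      Tendsto (fun k => eLpNorm (χ - v k) 2 volume) atTop (𝓝 0) →
      Tendsto (fun k => eLpNorm (φ + χ - (w k + v k)) 2 volume) atTop (𝓝 0) := by
    intro φ χ w v hφ hχ hw hv h1 h2
    have h := h1.add h2
    rw [add_zero] at h
    refine tendsto_of_tendsto_of_tendsto_of_le_of_le tendsto_const_nhds h (fun _ => bot_le)
      fun k => ?_
    have e : φ + χ - (w k + v k) = (φ - w k) + (χ - v k) := by abel
    simp only [e]
    exact eLpNorm_add_le (hφ.sub (hw k)) (hχ.sub (hv k)) (by norm_num)
  refine cft_ae_eq_of_tendsto hn (hf.add hg) ((memLp_cft hn hf).add (memLp_cft hn hg)).1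
    (u := fun R => truncate f R + truncate g R) (l := atTop)
    (fun R => (integrable_truncate hf R).add (integrable_truncate hg R))
    (fun R => (memLp_truncate hf R).add (memLp_truncate hg R)) ?_ ?_
  · exact hsplit hf.1 hg.1 (fun R => (memLp_truncate hf R).1) (fun R => (memLp_truncate hg R).1)
      (tendsto_eLpNorm_sub_truncate hf) (tendsto_eLpNorm_sub_truncate hg)
  · have hc : ∀ R, cftIntegral (truncate f R + truncate g R) =
        cftIntegral (truncate f R) + cftIntegral (truncate g R) := by
      intro R
      ext ω
      simp only [cftIntegral, Pi.add_apply, add_mul]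
      exact integral_add (integrable_mul_expI hn (integrable_truncate hf R) (by fun_prop))
        (integrable_mul_expI hn (integrable_truncate hg R) (by fun_prop))
    simp_rw [hc]
    exact hsplit (memLp_cft hn hf).1 (memLp_cft hn hg).1
      (fun R => (continuous_cftIntegral hn (integrable_truncate hf R)).aestronglyMeasurable)
      (fun R => (continuous_cftIntegral hn (integrable_truncate hg R)).aestronglyMeasurable)
      (tendsto_eLpNorm_cft_sub hn hf (integrable_truncate hf) (memLp_truncate hf)
        (tendsto_eLpNorm_sub_truncate hf))
      (tendsto_eLpNorm_cft_sub hn hg (integrable_truncate hg) (memLp_truncate hg)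
        (tendsto_eLpNorm_sub_truncate hg))

/-! ### Parseval's identity -/

theorem plancherelFactor_sq (n : ℕ) :
    (plancherelFactor n ^ 2).toReal = (2 * Real.pi) ^ n := by
  rw [plancherelFactor, ← ENNReal.rpow_natCast, ← ENNReal.rpow_mul]
  norm_num
  positivity

theorem integral_norm_cft_sq (hn : n % 4 = 2 ∨ n % 4 = 3) {f : E n → Cl n}
    (hf : MemLp f 2 volume) : ∫ ω, ‖cft f ω‖ ^ 2 = (2 * Real.pi) ^ n * ∫ x, ‖f x‖ ^ 2 := by
  rw [integral_norm_sq_eq (memLp_cft hn hf).1, integral_norm_sq_eq hf.1, eLpNorm_cft hn hf,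
    mul_pow, ENNReal.toReal_mul, plancherelFactor_sq]

/-- Polarization of Plancherel's identity. -/
theorem integral_inner_cft (hn : n % 4 = 2 ∨ n % 4 = 3) {f g : E n → Cl n}
    (hf : MemLp f 2 volume) (hg : MemLp g 2 volume) :
    ∫ ω, inner ℝ (cft f ω) (cft g ω) = (2 * Real.pi) ^ n * ∫ x, inner ℝ (f x) (g x) := by
  have hsq : ∀ {φ : E n → Cl n}, MemLp φ 2 volume → Integrable fun x => ‖φ x‖ ^ 2 :=
    fun hφ => hφ.integrable_norm_pow two_ne_zero
  have expand : ∀ {φ χ : E n → Cl n}, MemLp φ 2 volume → MemLp χ 2 volume →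
      ∫ x, inner ℝ (φ x) (χ x) =
        ((∫ x, ‖(φ + χ) x‖ ^ 2) - (∫ x, ‖φ x‖ ^ 2) - ∫ x, ‖χ x‖ ^ 2) / 2 := by
    intro φ χ hφ hχ
    have h1 := integral_sub (hsq (hφ.add hχ)) (hsq hφ)
    have h2 := integral_sub ((hsq (hφ.add hχ)).sub (hsq hφ)) (hsq hχ)
    rw [← h1]
    refine Eq.trans ?_ (congrArg (· / 2) h2)
    rw [← integral_div]
    congr 1
    ext x
    rw [real_inner_eq_norm_add_mul_self_sub_norm_mul_self_sub_norm_mul_self_div_two]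
    simp [pow_two]
  rw [expand (memLp_cft hn hf) (memLp_cft hn hg), expand hf hg,
    mul_div_assoc', mul_sub, mul_sub, ← integral_norm_cft_sq hn hf, ← integral_norm_cft_sq hn hg,
    ← integral_norm_cft_sq hn (hf.add hg)]
  congr 3
  refine integral_congr_ae ?_
  filter_upwards [cft_add hn hf hg] with x hx
  rw [hx]

theorem integrable_mul_reverse {α : Type*} [MeasurableSpace α] {μ : Measure α} {f g : α → Cl n}
    (hf : MemLp f 2 μ) (hg : MemLp g 2 μ) :
    Integrable (fun x => f x * CliffordAlgebra.reverse (g x)) μ :=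
  memLp_one_iff_integrable.1 ((mulL n).memLp_of_bilin 1 hf
    ((revL n).toContinuousLinearMap.comp_memLp' hg))

/-- Pairing with a constant $M$ gives $\langle M,f\widetilde g\rangle=\langle f,Mg\rangle$. Left
multiplication by $M$ commutes with the transform, so the scalar identity yields the multivector
one. -/
theorem l2Inner_cft (hn : n % 4 = 2 ∨ n % 4 = 3) {f g : E n → Cl n}
    (hf : MemLp f 2 volume) (hg : MemLp g 2 volume) :
    l2Inner (cft f) (cft g) = ((2 * Real.pi) ^ n : ℝ) • l2Inner f g := by
  refine ext_inner_left ℝ fun M => ?_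
  rw [inner_smul_right, l2Inner, l2Inner]
  rw [← integral_inner (integrable_mul_reverse (memLp_cft hn hf) (memLp_cft hn hg)),
    ← integral_inner (integrable_mul_reverse hf hg)]
  simp_rw [real_inner_comm _ M, inner_mul_reverse_left]
  have hg' : MemLp (fun x => M * g x) 2 volume := (mulL n M).comp_memLp' hg
  rw [← integral_inner_cft hn hf hg']
  refine integral_congr_ae ?_
  filter_upwards [cft_const_mul hn hg M] with x hx
  rw [hx]

/-! ### Rotations and similitudes -/

theorem SO.coe_inv (r : SO n) : (r⁻¹).1 = r.1.transpose := rfl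

theorem SO.transpose_mul_self (r : SO n) : r.1.transpose * r.1 = 1 :=
  (Matrix.mem_orthogonalGroup_iff' _ _).1 r.2.1

theorem isClosed_SO (n : ℕ) :
    IsClosed (Matrix.specialOrthogonalGroup (Fin n) ℝ : Set (Matrix (Fin n) (Fin n) ℝ)) := by
  have e : (Matrix.specialOrthogonalGroup (Fin n) ℝ : Set (Matrix (Fin n) (Fin n) ℝ)) =
      {A | A * A.transpose = 1} ∩ {A | A.det = 1} := by
    ext A
    change A ∈ Matrix.specialOrthogonalGroup (Fin n) ℝ ↔ _
    rw [Matrix.mem_specialOrthogonalGroup_iff, Matrix.mem_orthogonalGroup_iff]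
    rfl
  rw [e]
  exact (isClosed_eq (by fun_prop) (by fun_prop)).inter (isClosed_eq (by fun_prop) (by fun_prop))

/-- Makes Haar measure on $SO(n)$ σ-finite, as Fubini's theorem requires. -/
instance instSigmaCompactSpaceSO (n : ℕ) : SigmaCompactSpace (SO n) :=
  have : SigmaCompactSpace (Matrix (Fin n) (Fin n) ℝ) :=
    inferInstanceAs (SigmaCompactSpace (Fin n → Fin n → ℝ))
  (isClosed_SO n).sigmaCompactSpace

instance instSecondCountableSO (n : ℕ) : SecondCountableTopology (SO n) :=
  have : SecondCountableTopology (Matrix (Fin n) (Fin n) ℝ) :=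
    inferInstanceAs (SecondCountableTopology (Fin n → Fin n → ℝ))
  inferInstanceAs (SecondCountableTopology
    (Matrix.specialOrthogonalGroup (Fin n) ℝ : Set (Matrix (Fin n) (Fin n) ℝ)))

instance instSFiniteScaleMeasure (n : ℕ) : SFinite (scaleMeasure n) := by
  have : SigmaFinite ((volume : Measure ℝ).comap (Subtype.val : Set.Ioi (0 : ℝ) → ℝ)) := by
    refine SigmaFinite.of_map _ measurable_subtype_coe.aemeasurable ?_
    rw [map_comap_subtype_coe measurableSet_Ioi]
    infer_instance
  unfold scaleMeasure
  infer_instance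

instance instSFiniteMuMeasure (ν : Measure (SO n)) [SFinite ν] : SFinite (muMeasure ν) := by
  unfold muMeasure
  infer_instance

theorem rotate_mul (r s : SO n) (x : E n) : rotate (r * s) x = rotate r (rotate s x) := by
  simp [rotate, Matrix.mulVec_mulVec]

theorem rotate_one (x : E n) : rotate 1 x = x := by
  simp [rotate]

theorem inner_rotate (r : SO n) (x y : E n) :
    inner ℝ (rotate r x) (rotate r y) = inner ℝ x y := by
  simp only [rotate, EuclideanSpace.inner_eq_star_dotProduct, star_trivial]
  rw [Matrix.dotProduct_mulVec, ← Matrix.mulVec_transpose, Matrix.mulVec_mulVec,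
    SO.transpose_mul_self, Matrix.one_mulVec]

theorem inner_rotate_right (r : SO n) (x y : E n) :
    inner ℝ x (rotate r y) = inner ℝ (rotate r⁻¹ x) y := by
  rw [← inner_rotate r⁻¹, ← rotate_mul, inv_mul_cancel, rotate_one]

/-- Rotations as linear isometric equivalences. -/
def rotateEquiv (r : SO n) : E n ≃ₗᵢ[ℝ] E n where
  toFun := rotate r
  invFun := rotate r⁻¹
  map_add' x y := by simp [rotate, Matrix.mulVec_add]
  map_smul' c x := by simp [rotate, Matrix.mulVec_smul]
  left_inv x := by rw [← rotate_mul, inv_mul_cancel, rotate_one]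
  right_inv x := by rw [← rotate_mul, mul_inv_cancel, rotate_one]
  norm_map' x := by
    have h : ‖rotate r x‖ ^ 2 = ‖x‖ ^ 2 := by
      rw [← real_inner_self_eq_norm_sq, ← real_inner_self_eq_norm_sq, inner_rotate]
    exact (pow_left_inj₀ (norm_nonneg _) (norm_nonneg _) two_ne_zero).1 h

theorem rotate_smul (r : SO n) (c : ℝ) (x : E n) : rotate r (c • x) = c • rotate r x :=
  (rotateEquiv r).map_smul c x

theorem continuous_rotate_inv : Continuous fun q : SO n × E n => rotate q.1⁻¹ q.2 := by
  unfold rotate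
  simp only [SO.coe_inv]
  refine (PiLp.continuous_toLp 2 _).comp ?_
  exact Continuous.matrix_mulVec (by fun_prop) (by fun_prop)

/-- The similitude `x ↦ r⁻¹(s(x - b))`. -/
def similitude (s : ℝ) (hs : s ≠ 0) (r : SO n) (b : E n) : E n ≃ₜ E n :=
  ((Homeomorph.subRight b).trans (Homeomorph.smulOfNeZero s hs)).trans
    (rotateEquiv r⁻¹).toHomeomorph

theorem similitude_apply (s : ℝ) (hs : s ≠ 0) (r : SO n) (b x : E n) :
    similitude s hs r b x = rotate r⁻¹ (s • (x - b)) := rfl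

theorem map_similitude (s : ℝ) (hs : s ≠ 0) (r : SO n) (b : E n) :
    (volume : Measure (E n)).map (similitude s hs r b) =
      ENNReal.ofReal |(s ^ n)⁻¹| • volume := by
  have h1 : (volume : Measure (E n)).map (Homeomorph.subRight b) = volume :=
    (measurePreserving_sub_right volume b).map_eq
  have h2 : (volume : Measure (E n)).map (Homeomorph.smulOfNeZero s hs) =
      ENNReal.ofReal |(s ^ n)⁻¹| • volume := by
    refine (Measure.map_addHaar_smul _ hs).trans ?_
    simp only [finrank_euclideanSpace, Fintype.card_fin]
  have h3 : (volume : Measure (E n)).map (rotateEquiv r⁻¹).toHomeomorph = volume :=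
    (rotateEquiv r⁻¹).measurePreserving.map_eq
  have e : ⇑(similitude s hs r b) = (rotateEquiv r⁻¹).toHomeomorph ∘
      (Homeomorph.smulOfNeZero s hs) ∘ (Homeomorph.subRight b) := rfl
  rw [e, ← Measure.map_map (Homeomorph.measurable _)
    ((Homeomorph.measurable _).comp (Homeomorph.measurable _)),
    ← Measure.map_map (Homeomorph.measurable _) (Homeomorph.measurable _), h1, h2,
    Measure.map_smul, h3]

theorem quasiMeasurePreserving_similitude (s : ℝ) (hs : s ≠ 0) (r : SO n) (b : E n) :
    Measure.QuasiMeasurePreserving (similitude s hs r b) (volume : Measure (E n)) volume :=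
  ⟨(similitude s hs r b).measurable, by
    rw [map_similitude]; exact Measure.smul_absolutelyContinuous⟩

theorem eLpNorm_comp_similitude {G : Type*} [NormedAddCommGroup G] (s : ℝ) (hs : s ≠ 0) (r : SO n)
    (b : E n) (u : E n → G) :
    eLpNorm (fun x => u (similitude s hs r b x)) 2 volume =
      ENNReal.ofReal |(s ^ n)⁻¹| ^ (1 / 2 : ℝ) * eLpNorm u 2 volume := by
  have h := (similitude s hs r b).measurableEmbedding.eLpNorm_map_measure
    (μ := (volume : Measure (E n))) (p := 2) (g := u)
  rw [map_similitude, eLpNorm_smul_measure_of_ne_top (by simp)] at h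
  simp only [smul_eq_mul, one_div, ENNReal.toReal_inv, ENNReal.toReal_ofNat] at h
  rw [one_div]
  exact h.symm

theorem memLp_comp_similitude {G : Type*} [NormedAddCommGroup G] (s : ℝ) (hs : s ≠ 0) (r : SO n)
    (b : E n) {u : E n → G} (hu : MemLp u 2 volume) :
    MemLp (fun x => u (similitude s hs r b x)) 2 volume := by
  refine ⟨hu.1.comp_quasiMeasurePreserving (quasiMeasurePreserving_similitude s hs r b), ?_⟩
  rw [eLpNorm_comp_similitude]
  exact ENNReal.mul_lt_top (ENNReal.rpow_lt_top_of_nonneg (by norm_num) ENNReal.ofReal_ne_top) hu.2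

theorem integral_comp_similitude {G : Type*} [NormedAddCommGroup G] [NormedSpace ℝ G] (s : ℝ)
    (hs : s ≠ 0) (r : SO n) (b : E n) (u : E n → G) :
    ∫ x, u (similitude s hs r b x) = |(s ^ n)⁻¹| • ∫ x, u x := by
  have h := (similitude s hs r b).measurableEmbedding.integral_map
    (μ := (volume : Measure (E n))) u
  rw [map_similitude, integral_smul_measure, ENNReal.toReal_ofReal (abs_nonneg _)] at h
  exact h.symm

/-! ### Daughter wavelets -/

theorem scale_inv_ne_zero (a : Set.Ioi (0 : ℝ)) : (a : ℝ)⁻¹ ≠ 0 := inv_ne_zero (ne_of_gt a.2)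

theorem daughter_eq (ψ : E n → Cl n) (g : SIM n) (x : E n) :
    daughter ψ g x = ((g.1.1 : ℝ) ^ (-(n : ℝ) / 2)) •
      ψ (similitude (g.1.1 : ℝ)⁻¹ (scale_inv_ne_zero _) g.1.2 g.2 x) := rfl

theorem memLp_daughter {ψ : E n → Cl n} (hψ : MemLp ψ 2 volume) (g : SIM n) :
    MemLp (daughter ψ g) 2 volume :=
  (memLp_comp_similitude _ (scale_inv_ne_zero g.1.1) g.1.2 g.2 hψ).const_smul
    ((g.1.1 : ℝ) ^ (-(n : ℝ) / 2))

theorem daughter_congr_ae {ψ χ : E n → Cl n} (h : ψ =ᵐ[volume] χ) (g : SIM n) :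
    daughter ψ g =ᵐ[volume] daughter χ g := by
  filter_upwards [(quasiMeasurePreserving_similitude _ (scale_inv_ne_zero g.1.1) g.1.2 g.2).ae_eq h]
    with x hx
  rw [daughter_eq, daughter_eq]
  exact congrArg _ hx

theorem integrable_daughter {ψ : E n → Cl n} (hψ : Integrable ψ) (g : SIM n) :
    Integrable (daughter ψ g) := by
  have h := (similitude _ (scale_inv_ne_zero g.1.1) g.1.2
    g.2).measurableEmbedding.integrable_map_iff
    (μ := (volume : Measure (E n))) (g := ψ)
  rw [map_similitude] at h
  exact (h.1 (hψ.smul_measure (by simp))).smul ((g.1.1 : ℝ) ^ (-(n : ℝ) / 2))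

/-- The factor is in fact $1$, but only its finiteness matters for limits. -/
theorem exists_eLpNorm_daughter (g : SIM n) :
    ∃ K : ENNReal, K ≠ ⊤ ∧ ∀ ψ : E n → Cl n,
      eLpNorm (daughter ψ g) 2 volume = K * eLpNorm ψ 2 volume := by
  refine ⟨‖(g.1.1 : ℝ) ^ (-(n : ℝ) / 2)‖ₑ *
    ENNReal.ofReal |(((g.1.1 : ℝ)⁻¹) ^ n)⁻¹| ^ (1 / 2 : ℝ), ?_, fun ψ => ?_⟩
  · exact ENNReal.mul_ne_top enorm_ne_top (by simp)
  · rw [mul_assoc, ← eLpNorm_comp_similitude _ (scale_inv_ne_zero g.1.1) g.1.2 g.2 ψ,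
      ← eLpNorm_const_smul]
    rfl

/-- Substitute $x=a\,r y+b$: the exponent splits into $a r^{-1}\omega\cdot y$ and $\omega\cdot b$,
and the Jacobian $a^n$ turns $a^{-n/2}$ into $a^{n/2}$. -/
theorem cftIntegral_daughter (hn : n % 4 = 2 ∨ n % 4 = 3) (u : E n → Cl n) (g : SIM n) (ω : E n) :
    cftIntegral (daughter u g) ω = ((g.1.1 : ℝ) ^ ((n : ℝ) / 2)) •
      (cftIntegral u ((g.1.1 : ℝ) • rotate g.1.2⁻¹ ω) * expI n (-(inner ℝ ω g.2))) := by
  obtain ⟨⟨a, r⟩, b⟩ := g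
  have ha : (0 : ℝ) < a := a.2
  set S := similitude (a : ℝ)⁻¹ (scale_inv_ne_zero a) r b
  have hx : ∀ x, x = (a : ℝ) • rotate r (S x) + b := by
    intro x
    rw [similitude_apply, ← rotate_mul, mul_inv_cancel, rotate_one, smul_smul,
      mul_inv_cancel₀ ha.ne', one_smul, sub_add_cancel]
  have hin : ∀ x, inner ℝ ω x = inner ℝ ((a : ℝ) • rotate r⁻¹ ω) (S x) + inner ℝ ω b := by
    intro x
    conv_lhs => rw [hx x]
    rw [inner_add_right, inner_smul_right, inner_rotate_right, inner_smul_left]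
    simp
  let k : E n → Cl n := fun y => ((a : ℝ) ^ (-(n : ℝ) / 2)) • mulRightL (expI n (-(inner ℝ ω b)))
    (u y * expI n (-(inner ℝ ((a : ℝ) • rotate r⁻¹ ω) y)))
  have h1 : ∀ x, daughter u ((a, r), b) x * expI n (-(inner ℝ ω x)) = k (S x) := by
    intro x
    rw [daughter_eq, hin, neg_add, expI_add hn, smul_mul_assoc]
    simp only [k, mulRightL_apply, mul_assoc]
    rfl
  have hunit : expI n (-(inner ℝ ω b)) * expI n (inner ℝ ω b) = 1 := by
    rw [← expI_add hn, neg_add_cancel, expI_zero]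
  have hunit' : expI n (inner ℝ ω b) * expI n (-(inner ℝ ω b)) = 1 := by
    rw [← expI_add hn, add_neg_cancel, expI_zero]
  -- Right multiplication by the phase is invertible, so it leaves the integral without any
  -- integrability of `u`.
  let R : Cl n ≃L[ℝ] Cl n := ContinuousLinearEquiv.equivOfInverse
    (mulRightL (expI n (-(inner ℝ ω b)))) (mulRightL (expI n (inner ℝ ω b)))
    (fun M => by simp [mul_assoc, hunit]) (fun M => by simp [mul_assoc, hunit'])
  have h2 := R.integral_comp_comm (μ := (volume : Measure (E n)))
    (fun y => u y * expI n (-(inner ℝ ((a : ℝ) • rotate r⁻¹ ω) y)))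
  change ∫ y, mulRightL (expI n (-(inner ℝ ω b)))
        (u y * expI n (-(inner ℝ ((a : ℝ) • rotate r⁻¹ ω) y))) =
      cftIntegral u ((a : ℝ) • rotate r⁻¹ ω) * expI n (-(inner ℝ ω b)) at h2
  rw [cftIntegral]
  refine (integral_congr_ae (ae_of_all _ h1)).trans
    ((integral_comp_similitude _ (scale_inv_ne_zero a) r b k).trans ?_)
  simp only [k]
  rw [integral_smul, h2, smul_smul]
  congr 1
  rw [inv_pow, inv_inv, abs_of_pos (by positivity), ← Real.rpow_natCast, ← Real.rpow_add ha]
  congr 1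
  ring

theorem cft_daughter (hn : n % 4 = 2 ∨ n % 4 = 3) {ψ : E n → Cl n} (hψ : MemLp ψ 2 volume)
    (g : SIM n) :
    cft (daughter ψ g) =ᵐ[volume] fun ω => ((g.1.1 : ℝ) ^ ((n : ℝ) / 2)) •
      (cft ψ ((g.1.1 : ℝ) • rotate g.1.2⁻¹ ω) * expI n (-(inner ℝ ω g.2))) := by
  have ha : (g.1.1 : ℝ) ≠ 0 := ne_of_gt g.1.1.2
  have hS : ∀ ω, (g.1.1 : ℝ) • rotate g.1.2⁻¹ ω = similitude (g.1.1 : ℝ) ha g.1.2 0 ω := by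
    intro ω
    rw [similitude_apply, sub_zero, rotate_smul]
  obtain ⟨K, hK, hKe⟩ := exists_eLpNorm_daughter g
  have hsub : ∀ R, daughter ψ g - daughter (truncate ψ R) g = daughter (ψ - truncate ψ R) g := by
    intro R
    ext x
    simp [daughter, smul_sub]
  refine cft_ae_eq_of_tendsto hn (memLp_daughter hψ g) ?_ (u := fun R => daughter (truncate ψ R) g)
    (l := atTop) (fun R => integrable_daughter (integrable_truncate hψ R) g)
    (fun R => memLp_daughter (memLp_truncate hψ R) g) ?_ ?_
  · simp_rw [hS]
    have h1 := (memLp_comp_similitude _ ha g.1.2 0 (memLp_cft hn hψ)).1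
    have h2 : Continuous fun ω : E n => expI n (-(inner ℝ ω g.2)) :=
      (continuous_expI n).comp (by fun_prop)
    exact (h1.mul h2.aestronglyMeasurable).const_smul ((g.1.1 : ℝ) ^ ((n : ℝ) / 2))
  · simp_rw [hsub, hKe]
    have h := ENNReal.Tendsto.const_mul (a := K) (tendsto_eLpNorm_sub_truncate hψ) (Or.inr hK)
    rwa [mul_zero] at h
  · have h := tendsto_eLpNorm_cft_sub hn hψ (integrable_truncate hψ) (memLp_truncate hψ)
      (tendsto_eLpNorm_sub_truncate hψ)
    have h' := ENNReal.Tendsto.const_mul (a := ‖(g.1.1 : ℝ) ^ ((n : ℝ) / 2)‖ₑ *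
      ENNReal.ofReal |((g.1.1 : ℝ) ^ n)⁻¹| ^ (1 / 2 : ℝ)) h
      (Or.inr (ENNReal.mul_ne_top enorm_ne_top (by simp)))
    rw [mul_zero] at h'
    refine h'.congr fun R => ?_
    rw [mul_assoc, ← eLpNorm_comp_similitude _ ha g.1.2 0, ← eLpNorm_const_smul]
    refine eLpNorm_congr_norm_ae (Eventually.of_forall fun ω => ?_)
    simp only [Pi.smul_apply, Pi.sub_apply, cftIntegral_daughter hn, hS]
    rw [← smul_sub, ← sub_mul, norm_smul, norm_smul, norm_mul_expI hn]

/-! ### Multivectors that commute or anticommute with the pseudoscalar -/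

theorem pseudoscalar_mul_reverse (hn : n % 4 = 2 ∨ n % 4 = 3) {σ : ℝ} {M : Cl n}
    (hM : M * pseudoscalar n = σ • (pseudoscalar n * M)) :
    pseudoscalar n * CliffordAlgebra.reverse M =
      σ • (CliffordAlgebra.reverse M * pseudoscalar n) := by
  have h := congrArg CliffordAlgebra.reverse hM
  simp only [map_smul, CliffordAlgebra.reverse.map_mul, reverse_pseudoscalar hn, neg_mul, mul_neg,
    smul_neg, neg_inj] at h
  exact h

theorem expI_mul_reverse (hn : n % 4 = 2 ∨ n % 4 = 3) {σ : ℝ} (hσ : σ = 1 ∨ σ = -1) {M : Cl n}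
    (hM : M * pseudoscalar n = σ • (pseudoscalar n * M)) (t : ℝ) :
    expI n t * CliffordAlgebra.reverse M = CliffordAlgebra.reverse M * expI n (σ * t) := by
  have h := pseudoscalar_mul_reverse hn hM
  rcases hσ with rfl | rfl <;> simp [expI, add_mul, mul_add, h]

/-- Both sides equal $\sigma\widetilde M i_n M$. -/
theorem reverse_mul_self_comm (hn : n % 4 = 2 ∨ n % 4 = 3) {σ : ℝ} {M : Cl n}
    (hM : M * pseudoscalar n = σ • (pseudoscalar n * M)) :
    (CliffordAlgebra.reverse M * M) * pseudoscalar n =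
      pseudoscalar n * (CliffordAlgebra.reverse M * M) := by
  have h := pseudoscalar_mul_reverse hn hM
  rw [mul_assoc, hM, ← mul_assoc (pseudoscalar n), h, mul_smul_comm, smul_mul_assoc, mul_assoc]

/-- Left and right multiplication by $i_n$ both commute with the transform, so the relation passes
to frequencies. -/
theorem cft_mul_pseudoscalar (hn : n % 4 = 2 ∨ n % 4 = 3) {σ : ℝ} {ψ : E n → Cl n}
    (hψ : MemLp ψ 2 volume) (h : ∀ᵐ x, ψ x * pseudoscalar n = σ • (pseudoscalar n * ψ x)) :
    ∀ᵐ ω, cft ψ ω * pseudoscalar n = σ • (pseudoscalar n * cft ψ ω) := by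
  have h1 := cft_mul_const hn hψ (D := pseudoscalar n) rfl
  have h2 := cft_const_mul hn hψ (σ • pseudoscalar n)
  have hm : MemLp (fun x => ψ x * pseudoscalar n) 2 volume := (mulRightL _).comp_memLp' hψ
  have h3 : cft (fun x => ψ x * pseudoscalar n) =ᵐ[volume]
      cft (fun x => (σ • pseudoscalar n) * ψ x) := by
    refine cft_congr_ae hn hm ?_
    filter_upwards [h] with x hx
    rw [hx, smul_mul_assoc]
  filter_upwards [h1, h2, h3] with ω h1 h2 h3
  rw [← h1, h3, h2, smul_mul_assoc]

/-! ### The wavelet transform in the frequency domain -/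

/-- The dilated and rotated frequency `a r⁻¹ ω`. -/
def dilate (p : DilRot n) (ω : E n) : E n := (p.1 : ℝ) • rotate p.2⁻¹ ω

theorem dilate_eq_similitude (p : DilRot n) (ω : E n) :
    dilate p ω = similitude (p.1 : ℝ) (ne_of_gt p.1.2) p.2 0 ω := by
  rw [similitude_apply, sub_zero, rotate_smul, dilate]

theorem quasiMeasurePreserving_dilate (p : DilRot n) :
    Measure.QuasiMeasurePreserving (dilate p) (volume : Measure (E n)) volume := by
  have e : dilate p = similitude (p.1 : ℝ) (ne_of_gt p.1.2) p.2 0 :=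
    funext (dilate_eq_similitude p)
  rw [e]
  exact quasiMeasurePreserving_similitude _ _ _ _

/-- Statements valid for almost every frequency can thus be evaluated at $ar^{-1}\omega$ for almost
every $(p,\omega)$. -/
theorem quasiMeasurePreserving_uncurry_dilate (μ : Measure (DilRot n)) :
    Measure.QuasiMeasurePreserving (fun q : DilRot n × E n => dilate q.1 q.2)
      (μ.prod volume) volume := by
  refine QuasiMeasurePreserving.prod_of_right ?_
    (ae_of_all _ fun p => quasiMeasurePreserving_dilate p)
  have h : Continuous fun q : DilRot n × E n => dilate q.1 q.2 := by
    have h1 : Continuous fun q : DilRot n × E n => rotate q.1.2⁻¹ q.2 :=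
      continuous_rotate_inv.comp (by fun_prop : Continuous fun q : DilRot n × E n => (q.1.2, q.2))
    exact (by fun_prop : Continuous fun q : DilRot n × E n => (q.1.1 : ℝ)).smul h1
  exact h.measurable

/-- The symbol `a^{n/2} ψ̂(a r⁻¹ ω)~` of the wavelet transform. -/
def symbol (ψ : E n → Cl n) (p : DilRot n) (ω : E n) : Cl n :=
  ((p.1 : ℝ) ^ ((n : ℝ) / 2)) • CliffordAlgebra.reverse (cft ψ (dilate p ω))

theorem memLp_symbol (hn : n % 4 = 2 ∨ n % 4 = 3) {ψ : E n → Cl n} (hψ : MemLp ψ 2 volume)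
    (p : DilRot n) : MemLp (symbol ψ p) 2 volume := by
  have h := memLp_comp_similitude (p.1 : ℝ) (ne_of_gt p.1.2) p.2 0 (memLp_cft hn hψ)
  simp_rw [← dilate_eq_similitude] at h
  exact ((revL n).toContinuousLinearMap.comp_memLp' h).const_smul ((p.1 : ℝ) ^ ((n : ℝ) / 2))

theorem aestronglyMeasurable_symbol (hn : n % 4 = 2 ∨ n % 4 = 3) {ψ : E n → Cl n}
    (hψ : MemLp ψ 2 volume) (μ : Measure (DilRot n)) :
    AEStronglyMeasurable (fun q : DilRot n × E n => symbol ψ q.1 q.2) (μ.prod volume) := by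
  have h := (memLp_cft hn hψ).1.comp_quasiMeasurePreserving
    (quasiMeasurePreserving_uncurry_dilate μ)
  have h1 : AEStronglyMeasurable (fun q : DilRot n × E n => (q.1.1 : ℝ) ^ ((n : ℝ) / 2))
      (μ.prod volume) := by
    refine Measurable.aestronglyMeasurable ?_
    exact (measurable_subtype_coe.comp (measurable_fst.comp measurable_fst)).pow_const _
  exact h1.smul ((revL n).continuous.comp_aestronglyMeasurable h)

theorem symbol_mul_reverse (ψ : E n → Cl n) (p : DilRot n) (ω : E n) :
    symbol ψ p ω * CliffordAlgebra.reverse (symbol ψ p ω) = admissibilityIntegrand ψ ω p := by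
  have ha : (0 : ℝ) < p.1 := p.1.2
  simp only [symbol, admissibilityIntegrand, map_smul, CliffordAlgebra.reverse_reverse,
    smul_mul_assoc, mul_smul_comm, smul_smul]
  rw [← Real.rpow_add ha, add_halves, Real.rpow_natCast]
  rfl

theorem enorm_symbol_sq (ψ : E n → Cl n) (p : DilRot n) (ω : E n) :
    ‖symbol ψ p ω‖ₑ ^ 2 = ENNReal.ofReal (scalarPart n (admissibilityIntegrand ψ ω p)) := by
  rw [← symbol_mul_reverse, ← inner_eq_scalarPart, real_inner_self_eq_norm_sq,
    ENNReal.ofReal_pow (norm_nonneg _), ofReal_norm]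

theorem lintegral_enorm_symbol_sq {ν : Measure (SO n)} {ψ : E n → Cl n} {C : Cl n}
    (hψ : IsAdmissible ν ψ C) :
    ∀ᵐ ω : E n, ∫⁻ p, ‖symbol ψ p ω‖ₑ ^ 2 ∂(muMeasure ν) = ENNReal.ofReal (scalarPart n C) := by
  filter_upwards [hψ.integrable, hψ.integral_eq] with ω h1 h2
  set s : Cl n →L[ℝ] ℝ := LinearMap.toContinuousLinearMap (scalarPart n)
  have hs : ∀ M, s M = scalarPart n M := fun _ => rfl
  simp_rw [enorm_symbol_sq, ← hs]
  rw [← ofReal_integral_eq_lintegral_ofReal (s.integrable_comp h1), s.integral_comp_comm h1, h2]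
  refine ae_of_all _ fun p => ?_
  change 0 ≤ scalarPart n _
  rw [← symbol_mul_reverse, ← inner_eq_scalarPart]
  exact real_inner_self_nonneg

/-- The product of the Fourier transform of `f` with the symbol of the wavelet transform. -/
def spectrumAt (ψ f : E n → Cl n) (p : DilRot n) (ω : E n) : Cl n := cft f ω * symbol ψ p ω

theorem integrable_spectrumAt (hn : n % 4 = 2 ∨ n % 4 = 3) {ψ f : E n → Cl n}
    (hψ : MemLp ψ 2 volume) (hf : MemLp f 2 volume) (p : DilRot n) :
    Integrable (spectrumAt ψ f p) :=
  memLp_one_iff_integrable.1 ((mulL n).memLp_of_bilin 1 (memLp_cft hn hf) (memLp_symbol hn hψ p))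

/-- By Tonelli, integrate over $p$ first: admissibility gives $\int|\text{symbol}|^2d\mu=\langle
C\rangle_0$ for almost every $\omega$, leaving a multiple of $\|\widehat f\|^2$. -/
theorem memLp_spectrumAt (hn : n % 4 = 2 ∨ n % 4 = 3) {ν : Measure (SO n)} [SFinite ν]
    {ψ f : E n → Cl n} {C : Cl n} (hψ : IsAdmissible ν ψ C) (hf : MemLp f 2 volume) :
    MemLp (fun q : DilRot n × E n => spectrumAt ψ f q.1 q.2) 2 ((muMeasure ν).prod volume) := by
  have hF : AEStronglyMeasurable (fun q : DilRot n × E n => cft f q.2)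
      ((muMeasure ν).prod volume) := (memLp_cft hn hf).1.comp_snd
  have hS := aestronglyMeasurable_symbol hn hψ.memLp (muMeasure ν)
  refine ⟨hF.mul hS, ?_⟩
  have hle : eLpNorm (fun q : DilRot n × E n => spectrumAt ψ f q.1 q.2) 2
      ((muMeasure ν).prod volume) ^ 2 < ⊤ := by
    rw [eLpNorm_two_sq]
    calc ∫⁻ q, ‖spectrumAt ψ f q.1 q.2‖ₑ ^ 2 ∂((muMeasure ν).prod volume)
        ≤ ∫⁻ q, ‖mulL n‖ₑ ^ 2 * (‖cft f q.2‖ₑ ^ 2 * ‖symbol ψ q.1 q.2‖ₑ ^ 2)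
            ∂((muMeasure ν).prod volume) := by
          refine lintegral_mono fun q => ?_
          rw [← mul_pow, ← mul_pow, ← mul_assoc]
          gcongr
          exact (mulL n).le_opENorm₂ _ _
      _ = ‖mulL n‖ₑ ^ 2 * ∫⁻ ω, ∫⁻ p, ‖cft f ω‖ₑ ^ 2 * ‖symbol ψ p ω‖ₑ ^ 2 ∂(muMeasure ν) := by
          rw [lintegral_const_mul' _ _ (by finiteness)]
          congr 1
          exact lintegral_prod_symm _ ((hF.enorm.pow_const 2).mul (hS.enorm.pow_const 2))
      _ = ‖mulL n‖ₑ ^ 2 * (eLpNorm (cft f) 2 volume ^ 2 * ENNReal.ofReal (scalarPart n C)) := by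
          congr 1
          rw [eLpNorm_two_sq, ← lintegral_mul_const' _ _ ENNReal.ofReal_ne_top]
          refine lintegral_congr_ae ?_
          filter_upwards [lintegral_enorm_symbol_sq hψ] with ω hω
          rw [lintegral_const_mul' _ _ (by finiteness), hω]
      _ < ⊤ := by
          have := (memLp_cft hn hf).2
          finiteness
  by_contra h
  rw [not_lt, top_le_iff] at h
  simp [h] at hle

theorem ae_memLp_spectrumAt (hn : n % 4 = 2 ∨ n % 4 = 3) {ν : Measure (SO n)} [SFinite ν]
    {ψ f : E n → Cl n} {C : Cl n} (hψ : IsAdmissible ν ψ C) (hf : MemLp f 2 volume) :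
    ∀ᵐ p ∂(muMeasure ν), MemLp (spectrumAt ψ f p) 2 volume := by
  have h := memLp_spectrumAt hn hψ hf
  have h2 : ∫⁻ q, ‖spectrumAt ψ f q.1 q.2‖ₑ ^ 2 ∂((muMeasure ν).prod volume) ≠ ⊤ := by
    rw [← eLpNorm_two_sq]
    exact (ENNReal.pow_lt_top h.2).ne
  rw [lintegral_prod _ (h.1.enorm.pow_const 2)] at h2
  filter_upwards [ae_lt_top' (h.1.enorm.pow_const 2).lintegral_prod_right' h2] with p hp
  refine ⟨(integrable_spectrumAt hn hψ.memLp hf p).1, ?_⟩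
  rw [← eLpNorm_two_sq] at hp
  by_contra h
  rw [not_lt, top_le_iff] at h
  simp [h] at hp

/-- After Parseval, reversion puts the phase to the left of $\widehat\psi^\sim$; moving it to the
right multiplies its exponent by $\sigma$, hence the point $-\sigma b$. -/
theorem waveletTransform_eq (hn : n % 4 = 2 ∨ n % 4 = 3) {σ : ℝ} (hσ : σ = 1 ∨ σ = -1)
    {ψ f : E n → Cl n} (hψ : MemLp ψ 2 volume)
    (hψσ : ∀ᵐ x, ψ x * pseudoscalar n = σ • (pseudoscalar n * ψ x)) (hf : MemLp f 2 volume)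
    (p : DilRot n) (b : E n) :
    waveletTransform ψ f (p, b) =
      ((2 * Real.pi) ^ n)⁻¹ • cftIntegral (spectrumAt ψ f p) (-(σ • b)) := by
  have hpi : (2 * Real.pi) ^ n ≠ 0 := by positivity
  rw [waveletTransform, eq_inv_smul_iff₀ hpi, ← l2Inner_cft hn hf (memLp_daughter hψ _), l2Inner,
    cftIntegral]
  refine integral_congr_ae ?_
  filter_upwards [cft_daughter hn hψ (p, b),
    (quasiMeasurePreserving_dilate p).ae (cft_mul_pseudoscalar hn hψ hψσ)] with ω h1 h2
  rw [h1, spectrumAt, symbol]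
  simp only [map_smul, CliffordAlgebra.reverse.map_mul, reverse_expI hn, neg_neg]
  change cft f ω * (((p.1 : ℝ) ^ ((n : ℝ) / 2)) •
    (expI n (inner ℝ ω b) * CliffordAlgebra.reverse (cft ψ (dilate p ω)))) = _
  rw [expI_mul_reverse hn hσ h2, mul_smul_comm, mul_smul_comm, smul_mul_assoc, mul_assoc,
    inner_neg_left, neg_neg, inner_smul_left, real_inner_comm]
  rfl

theorem measurePreserving_neg_sign_smul {σ : ℝ} (hσ : σ = 1 ∨ σ = -1) :
    MeasurePreserving (fun b : E n => -(σ • b)) volume volume := by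
  rcases hσ with rfl | rfl
  · simpa using Measure.measurePreserving_neg (volume : Measure (E n))
  · simpa using! MeasurePreserving.id (volume : Measure (E n))

theorem measurableEmbedding_neg_sign_smul {σ : ℝ} (hσ : σ = 1 ∨ σ = -1) :
    MeasurableEmbedding (fun b : E n => -(σ • b)) := by
  rcases hσ with rfl | rfl
  · simpa using (MeasurableEquiv.neg (E n)).measurableEmbedding
  · simpa using! MeasurableEmbedding.id

theorem aestronglyMeasurable_waveletTransform {ψ f : E n → Cl n} (hψ : MemLp ψ 2 volume)
    (hf : MemLp f 2 volume) (lam : Measure (SIM n)) :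
    AEStronglyMeasurable (waveletTransform ψ f) lam := by
  -- Passing to strongly measurable representatives leaves the transform unchanged at every `g`,
  -- since similitudes preserve null sets.
  set ψ' := hψ.1.mk ψ
  set f' := hf.1.mk f
  have e : waveletTransform ψ f = waveletTransform ψ' f' := by
    ext g
    refine integral_congr_ae ?_
    filter_upwards [hf.1.ae_eq_mk, daughter_congr_ae hψ.1.ae_eq_mk g] with x h1 h2
    rw [h1, h2]
  rw [e]
  refine StronglyMeasurable.aestronglyMeasurable ?_
  have h1 : StronglyMeasurable fun q : SIM n × E n => f' q.2 :=
    hf.1.stronglyMeasurable_mk.comp_measurable measurable_snd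
  have hc : Continuous fun q : SIM n × E n =>
      rotate q.1.1.2⁻¹ ((q.1.1.1 : ℝ)⁻¹ • (q.2 - q.1.2)) := by
    have hi : Continuous fun q : SIM n × E n => (q.1.1.1 : ℝ)⁻¹ :=
      Continuous.inv₀ (by fun_prop) fun q => ne_of_gt q.1.1.1.2
    exact continuous_rotate_inv.comp
      ((by fun_prop : Continuous fun q : SIM n × E n => q.1.1.2).prodMk
        (hi.smul (by fun_prop : Continuous fun q : SIM n × E n => q.2 - q.1.2)))
  have h2 : StronglyMeasurable fun q : SIM n × E n => daughter ψ' q.1 q.2 := by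
    have hm : Measurable fun q : SIM n × E n => (q.1.1.1 : ℝ) ^ (-(n : ℝ) / 2) :=
      (by fun_prop : Continuous fun q : SIM n × E n => (q.1.1.1 : ℝ)).measurable.pow_const _
    exact hm.stronglyMeasurable.smul (hψ.1.stronglyMeasurable_mk.comp_measurable hc.measurable)
  exact (h1.mul ((revL n).continuous.comp_stronglyMeasurable h2)).integral_prod_right'

theorem memLp_waveletTransform (hn : n % 4 = 2 ∨ n % 4 = 3) {σ : ℝ} (hσ : σ = 1 ∨ σ = -1)
    {ν : Measure (SO n)} [SFinite ν] {ψ f : E n → Cl n} {C : Cl n} (hψ : IsAdmissible ν ψ C)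
    (hψσ : ∀ᵐ x, ψ x * pseudoscalar n = σ • (pseudoscalar n * ψ x)) (hf : MemLp f 2 volume) :
    MemLp (waveletTransform ψ f) 2 (simMeasure ν) := by
  have hm := aestronglyMeasurable_waveletTransform hψ.memLp hf (simMeasure ν)
  refine ⟨hm, ?_⟩
  set c : ENNReal := ‖((2 * Real.pi) ^ n)⁻¹‖ₑ with hc
  -- For almost every `p` the spectrum lies in $L^1\cap L^2$, so Plancherel applies in $b$.
  have key : eLpNorm (waveletTransform ψ f) 2 (simMeasure ν) ^ 2 =
      (c * plancherelFactor n) ^ 2 * eLpNorm (fun q : DilRot n × E n => spectrumAt ψ f q.1 q.2) 2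
        ((muMeasure ν).prod volume) ^ 2 := by
    have hcf : (c * plancherelFactor n) ^ 2 ≠ ⊤ := by
      have := plancherelFactor_ne_top n
      finiteness
    rw [eLpNorm_two_sq, eLpNorm_two_sq, simMeasure, lintegral_prod _ (hm.enorm.pow_const 2),
      lintegral_prod _ ((memLp_spectrumAt hn hψ hf).1.enorm.pow_const 2),
      ← lintegral_const_mul' _ _ hcf]
    refine lintegral_congr_ae ?_
    filter_upwards [ae_memLp_spectrumAt hn hψ hf] with p hp
    have hi := integrable_spectrumAt hn hψ.memLp hf p
    simp_rw [waveletTransform_eq hn hσ hψ.memLp hψσ hf p, enorm_smul, mul_pow]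
    rw [lintegral_const_mul' _ _ (by finiteness),
      (measurePreserving_neg_sign_smul hσ).lintegral_comp_emb (measurableEmbedding_neg_sign_smul hσ)
        (fun ω => ‖cftIntegral (spectrumAt ψ f p) ω‖ₑ ^ 2),
      ← eLpNorm_two_sq, ← eLpNorm_congr_ae (cft_ae_eq_cftIntegral hn hi hp), eLpNorm_cft hn hp,
      ← eLpNorm_two_sq]
    simp only [hc, mul_pow, mul_assoc]
  have hlt : eLpNorm (waveletTransform ψ f) 2 (simMeasure ν) ^ 2 < ⊤ := by
    rw [key]
    have := plancherelFactor_ne_top n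
    have := (memLp_spectrumAt hn hψ hf).2
    finiteness
  by_contra h
  rw [not_lt, top_le_iff] at h
  simp [h] at hlt

/-- The orthogonality relation for the wavelet transform, in the frequency domain. -/
theorem integral_waveletTransform_mul_reverse (hn : n % 4 = 2 ∨ n % 4 = 3) {σ : ℝ}
    (hσ : σ = 1 ∨ σ = -1) {ν : Measure (SO n)} [SFinite ν] {ψ f h : E n → Cl n} {C : Cl n}
    (hψ : IsAdmissible ν ψ C)
    (hψσ : ∀ᵐ x, ψ x * pseudoscalar n = σ • (pseudoscalar n * ψ x)) (hf : MemLp f 2 volume)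
    (hh : MemLp h 2 volume) :
    ∫ g, waveletTransform ψ f g * CliffordAlgebra.reverse (waveletTransform ψ h g) ∂(simMeasure ν) =
      ((2 * Real.pi) ^ n)⁻¹ • ∫ ω, cft f ω * C * CliffordAlgebra.reverse (cft h ω) := by
  have hint := integrable_mul_reverse (memLp_waveletTransform hn hσ hψ hψσ hf)
    (memLp_waveletTransform hn hσ hψ hψσ hh)
  have hint2 := integrable_mul_reverse (memLp_spectrumAt hn hψ hf) (memLp_spectrumAt hn hψ hh)
  have hpi : (2 * Real.pi) ^ n ≠ 0 := by positivity
  have h1 : ∀ᵐ p ∂(muMeasure ν),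
      ∫ b, waveletTransform ψ f (p, b) * CliffordAlgebra.reverse (waveletTransform ψ h (p, b)) =
        ((2 * Real.pi) ^ n)⁻¹ • ∫ ω, spectrumAt ψ f p ω *
          CliffordAlgebra.reverse (spectrumAt ψ h p ω) := by
    filter_upwards [ae_memLp_spectrumAt hn hψ hf, ae_memLp_spectrumAt hn hψ hh] with p hp hp'
    have hi := integrable_spectrumAt hn hψ.memLp hf p
    have hi' := integrable_spectrumAt hn hψ.memLp hh p
    simp_rw [waveletTransform_eq hn hσ hψ.memLp hψσ hf p,
      waveletTransform_eq hn hσ hψ.memLp hψσ hh p, map_smul, smul_mul_assoc, mul_smul_comm]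
    rw [integral_smul, integral_smul,
      (measurePreserving_neg_sign_smul hσ).integral_comp (measurableEmbedding_neg_sign_smul hσ)
        (fun ω => cftIntegral (spectrumAt ψ f p) ω *
          CliffordAlgebra.reverse (cftIntegral (spectrumAt ψ h p) ω))]
    have h2 := l2Inner_cft hn hp hp'
    have h3 : l2Inner (cft (spectrumAt ψ f p)) (cft (spectrumAt ψ h p)) =
        ∫ ω, cftIntegral (spectrumAt ψ f p) ω *
          CliffordAlgebra.reverse (cftIntegral (spectrumAt ψ h p) ω) := by
      refine integral_congr_ae ?_
      filter_upwards [cft_ae_eq_cftIntegral hn hi hp, cft_ae_eq_cftIntegral hn hi' hp'] with ω h4 h5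
      rw [h4, h5]
    rw [← h3, h2, inv_smul_smul₀ hpi]
    rfl
  have hswap := integral_integral_swap (μ := muMeasure ν) (ν := (volume : Measure (E n)))
    (f := fun p ω => spectrumAt ψ f p ω * CliffordAlgebra.reverse (spectrumAt ψ h p ω)) hint2
  rw [simMeasure] at hint ⊢
  rw [integral_prod _ hint, integral_congr_ae h1, integral_smul, hswap]
  congr 1
  refine integral_congr_ae ?_
  filter_upwards [hψ.integrable, hψ.integral_eq] with ω h2 h3
  -- The two symbols meet in the middle as the admissibility integrand; the outer factors do not
  -- depend on `p`.
  have h4 : ∀ p, spectrumAt ψ f p ω * CliffordAlgebra.reverse (spectrumAt ψ h p ω) =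
      (mulRightL (CliffordAlgebra.reverse (cft h ω)) ∘L mulL n (cft f ω))
        (admissibilityIntegrand ψ ω p) := by
    intro p
    rw [← symbol_mul_reverse]
    simp [spectrumAt, CliffordAlgebra.reverse.map_mul, mul_assoc]
  simp_rw [h4]
  rw [ContinuousLinearMap.integral_comp_comm _ h2, h3]
  simp

theorem admissibilityConstant_comm (hn : n % 4 = 2 ∨ n % 4 = 3) {σ : ℝ}
    {ν : Measure (SO n)} [SFinite ν] {ψ : E n → Cl n} {C : Cl n} (hψ : IsAdmissible ν ψ C)
    (hψσ : ∀ᵐ x, ψ x * pseudoscalar n = σ • (pseudoscalar n * ψ x)) :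
    C * pseudoscalar n = pseudoscalar n * C := by
  have h1 := (quasiMeasurePreserving_uncurry_dilate (muMeasure ν)).ae
    (cft_mul_pseudoscalar hn hψ.memLp hψσ)
  have h2 : ∀ᵐ ω : E n, ∀ᵐ p ∂(muMeasure ν), cft ψ (dilate p ω) * pseudoscalar n =
      σ • (pseudoscalar n * cft ψ (dilate p ω)) :=
    Measure.ae_ae_of_ae_prod (Measure.measurePreserving_swap.quasiMeasurePreserving.ae h1)
  -- `C` is constant, so a single good frequency suffices.
  obtain ⟨ω, h2, h3, h4⟩ := (h2.and (hψ.integrable.and hψ.integral_eq)).exists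
  have e1 := (mulRightL (pseudoscalar n)).integral_comp_comm h3
  have e2 := (mulL n (pseudoscalar n)).integral_comp_comm h3
  rw [h4] at e1 e2
  simp only [mulRightL_apply, mulL_apply] at e1 e2
  rw [← e1, ← e2]
  refine integral_congr_ae ?_
  filter_upwards [h2] with p hp
  simp only [admissibilityIntegrand, smul_mul_assoc, mul_smul_comm]
  congr 1
  exact reverse_mul_self_comm hn hp

/-! ### The reproducing kernel -/

theorem kernel_eq_reverse_waveletTransform (ψ : E n → Cl n) (C : Cl n) (g g' : SIM n) :
    kernel ψ C g g' = CliffordAlgebra.reverse (waveletTransform ψ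
      (fun x => daughter ψ g' x * CliffordAlgebra.reverse (Ring.inverse C)) g) := by
  rw [← revL_apply, waveletTransform, l2Inner, ← (revL n).integral_comp_comm]
  simp [kernel, l2Inner, CliffordAlgebra.reverse.map_mul, mul_assoc]

theorem exists_sign {ψ : E n → Cl n} {ε : ℤ} (hn : n % 4 = 2 ∨ n % 4 = 3) (hε : HasParity ψ ε) :
    ∃ σ : ℝ, (σ = 1 ∨ σ = -1) ∧ ∀ᵐ x, ψ x * pseudoscalar n = σ • (pseudoscalar n * ψ x) := by
  rcases hn with hn | hn
  · have he : Even n := Nat.even_iff.2 (by omega)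
    rcases hε.1 hn with ⟨-, h⟩ | ⟨-, h⟩
    · refine ⟨1, Or.inl rfl, ?_⟩
      filter_upwards [h] with x hx
      rw [one_smul, mul_pseudoscalar_of_mem_even he hx]
    · refine ⟨-1, Or.inr rfl, ?_⟩
      filter_upwards [h] with x hx
      rw [neg_one_smul, mul_pseudoscalar_of_mem_odd he hx]
  · refine ⟨1, Or.inl rfl, ae_of_all _ fun x => ?_⟩
    rw [one_smul, mul_pseudoscalar_of_odd (Nat.odd_iff.2 (by omega))]

/-- The sign $-1$ occurs only for even $n$. -/
theorem signedConstant_eq {ψ : E n → Cl n} {ε : ℤ} (hn : n % 4 = 2 ∨ n % 4 = 3)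
    (hε : HasParity ψ ε) (C : Cl n) : signedConstant ε C = C := by
  rcases hn with hn | hn
  · have he : Even n := Nat.even_iff.2 (by omega)
    rcases hε.1 hn with ⟨rfl, -⟩ | ⟨rfl, -⟩ <;> simp [signedConstant, he.neg_one_pow]
  · rw [hε.2 hn]
    simp [signedConstant]

end CliffordWavelet

end

theorem mainTheorem5 (n : ℕ) (hn : n % 4 = 2 ∨ n % 4 = 3)
    (ν : Measure (SO n)) [ν.IsHaarMeasure]
    (ψ : E n → Cl n) (ε : ℤ) (hε : HasParity ψ ε) (C : Cl n) (hψ : IsAdmissible ν ψ C)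
    (f : E n → Cl n) (hf : MemLp f 2 volume) :
    MemLp (waveletTransform ψ f) 2 (simMeasure ν) ∧
      ∀ g' : SIM n,
        MemLp (fun g => kernel ψ (signedConstant ε C) g g') 2 (simMeasure ν) ∧
        Integrable (fun g => waveletTransform ψ f g * kernel ψ (signedConstant ε C) g g')
          (simMeasure ν) ∧
        waveletTransform ψ f g' =
          ∫ g, waveletTransform ψ f g * kernel ψ (signedConstant ε C) g g' ∂(simMeasure ν) := by
  obtain ⟨σ, hσ, hψσ⟩ := exists_sign hn hε
  rw [signedConstant_eq hn hε]
  have hT := memLp_waveletTransform hn hσ hψ hψσ hf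
  refine ⟨hT, fun g' => ?_⟩
  have hd := memLp_daughter hψ.memLp g'
  set D := CliffordAlgebra.reverse (Ring.inverse C)
  have hh : MemLp (fun x => daughter ψ g' x * D) 2 volume := (mulRightL D).comp_memLp' hd
  have hTh := memLp_waveletTransform hn hσ hψ hψσ hh
  simp_rw [kernel_eq_reverse_waveletTransform]
  refine ⟨(revL n).toContinuousLinearMap.comp_memLp' hTh, integrable_mul_reverse hT hTh, ?_⟩
  rw [integral_waveletTransform_mul_reverse hn hσ hψ hψσ hf hh]
  have hpi : (2 * Real.pi) ^ n ≠ 0 := by positivity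
  have hC : Commute C (pseudoscalar n) := admissibilityConstant_comm hn hψ hψσ
  have hCinv : Ring.inverse C * pseudoscalar n = pseudoscalar n * Ring.inverse C := by
    obtain ⟨u, rfl⟩ := hψ.isUnit
    rw [Ring.inverse_unit]
    exact (Commute.units_inv_left hC).eq
  have hD : D * pseudoscalar n = pseudoscalar n * D := by
    have h := pseudoscalar_mul_reverse hn (σ := 1) (by rw [one_smul, hCinv])
    rw [one_smul] at h
    exact h.symm
  -- Parseval moves the left side to frequencies, where the two integrands agree because
  -- $C\widetilde D=CC^{-1}=1$.
  rw [eq_inv_smul_iff₀ hpi, waveletTransform, ← l2Inner_cft hn hf hd]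
  refine integral_congr_ae ?_
  filter_upwards [cft_mul_const hn hd hD] with ω h
  rw [h, CliffordAlgebra.reverse.map_mul, CliffordAlgebra.reverse_reverse, mul_assoc (cft f ω),
    ← mul_assoc C, Ring.mul_inverse_cancel C hψ.isUnit, one_mul]
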